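/- Definitions. Machines are deterministic multitape Turing machines; an oracle machine also has a query tape on which it can write a string, and in one step it can ask whether this string belongs to the oracle. An oracle (language) is a set $A\subseteq\{0,1\}^*$; it is also regarded as a subset of $\mathbb N$ by identifying the $(n+1)$-th string in length-lexicographic order with $n$. An oracle $A$ is \emph{low for speed} if for every computable language $L\subseteq\{0,1\}^*$ and every $f:\{0,1\}^*\to\mathbb N$: whenever some machine with oracle $A$ decides $L$ and halts on each input $x$ within $f(x)$ steps, there are a machine without oracle and a polynomial $p$ such that this machine decides $L$ and halts on each input $x$ within $p(f(x))$ steps. A set $G\subseteq\mathbb N$ is \emph{$1$-generic} if for every computably enumerable set $W\subseteq\{0,1\}^*$, either some finite prefix of (the characteristic sequence of) $G$ belongs to $W$, or some finite prefix of $G$ has no extension in $W$. A Turing degree is $1$-generic if it contains a $1$-generic set. Theorem. (1) Every $1$-generic Turing degree contains a low for speed set. (2) Specifically, if $G\subseteq\mathbb N$ is $1$-generic, then $S_G=\{0^{2^n} : n\in G\}$ is low for speed, and $S_G$ is Turing equivalent to $G$. (3) Consequently, the set $\mathsf{LFS}=\{A\subseteq\{0,1\}^* : A \text{ is low for speed}\}$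 has the cardinality of the continuum. -/

import Mathlib

namespace LowSpeed

/-! ### Oracle Turing machines with a query tape -/

/-- Tape symbols: `none` is the blank, `some (Sum.inl b)` is the bit `b`, and
`some (Sum.inr a)` is an auxiliary symbol of the machine. -/
abbrev Sym (Aux : Type) : Type := Option (Bool ⊕ Aux)

/-- The symbol of a bit. -/
def Sym.bit {Aux : Type} (b : Bool) : Sym Aux := some (Sum.inl b)

/-- What a machine with tapes `0, …, k` does in a given state. Each instruction other than `halt`
takes one step.
* `halt b`: stop with output `b`.
* `work f`: if `s i` is the symbol scanned on tape `i`, and `f s = (q, a)`, then on each tape `i`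
  replace the scanned symbol by `(a i).1` and move the head as told by `(a i).2` (`none`: stay);
  the next state is `q`.
* `append b q`: write the bit `b` on the next cell of the query tape; the next state is `q`.
* `query y n`: ask whether the string on the query tape belongs to the oracle, and erase the query
  tape; the next state is `y` if the answer is yes and `n` if it is no. -/
inductive Instr (k : ℕ) (Aux State : Type) : Type
  | halt (b : Bool)
  | work (f : (Fin (k + 1) → Sym Aux) → State × (Fin (k + 1) → Sym Aux × Option Turing.Dir))
  | append (b : Bool) (q : State)
  | query (y n : State)

/-- A deterministic multitape oracle Turing machine: finitely many states, finitely many symbols,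
two-way infinite tapes `0, …, k` (tape `0` carries the input), and a query tape. -/
structure OracleTM where
  k : ℕ
  Aux : Type
  State : Type
  finite_aux : Finite Aux
  finite_state : Finite State
  start : State
  program : State → Instr k Aux State

namespace OracleTM

/-- A configuration: the state, the tapes with their heads, and the string on the query tape. -/
structure Cfg (M : OracleTM) where
  state : M.State
  tape : Fin (M.k + 1) → Turing.Tape (Sym M.Aux)
  queryTape : List Bool

/-- Move the head of a tape, or let it stay. -/
def shift {Γ : Type} [Inhabited Γ] : Option Turing.Dir → Turing.Tape Γ → Turing.Tape Γ
  | none, T => T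
  | some d, T => T.move d

open Classical in
/-- One step of `M` with oracle `A`; a halted configuration does not change. -/
noncomputable def step (M : OracleTM) (A : Set (List Bool)) (c : M.Cfg) : M.Cfg :=
  match M.program c.state with
  | .halt _ => c
  | .work f =>
      let r := f fun i => (c.tape i).head
      { state := r.1
        tape := fun i => shift (r.2 i).2 ((c.tape i).write (r.2 i).1)
        queryTape := c.queryTape }
  | .append b q => { state := q, tape := c.tape, queryTape := c.queryTape ++ [b] }
  | .query y n =>
      { state := if c.queryTape ∈ A then y else n, tape := c.tape, queryTape := [] }

/-- The initial configuration on input `x`: the input is written on tape `0`, with the head on its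
first symbol; all other tapes are empty. -/
def init (M : OracleTM) (x : List Bool) : M.Cfg where
  state := M.start
  tape := fun i => Turing.Tape.mk₁ (if i = 0 then x.map Sym.bit else [])
  queryTape := []

/-- The configuration of `M` with oracle `A` on input `x` after `t` steps. -/
noncomputable def run (M : OracleTM) (A : Set (List Bool)) (x : List Bool) (t : ℕ) : M.Cfg :=
  (M.step A)^[t] (M.init x)

/-- With oracle `A` and input `x`, `M` has halted with output `b` after at most `t` steps. -/
def HaltsWithin (M : OracleTM) (A : Set (List Bool)) (x : List Bool) (t : ℕ) (b : Bool) : Prop :=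
  ∃ s ≤ t, M.program (M.run A x s).state = .halt b

/-- With oracle `A`, `M` decides the language `L`, and on every input `x` its running time is at
most `f x`. -/
def DecidesInTime (M : OracleTM) (A L : Set (List Bool)) (f : List Bool → ℕ) : Prop :=
  ∀ x, ∃ b, M.HaltsWithin A x (f x) b ∧ (b = true ↔ x ∈ L)

/-- `M` is a machine without oracle: it has no query states. -/
def OracleFree (M : OracleTM) : Prop :=
  ∀ q y n, M.program q ≠ .query y n

end OracleTM

/-! ### Lowness for speed -/

/-- `A` is low for speed: every computable language that some machine decides with oracle `A` in
time `f` is decided by a machine without oracle in time `p ∘ f` for some polynomial `p`. Time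
bounds are functions of the input itself, and not only of its length. (A machine without oracle
never looks at the oracle; it is run with `∅`.) -/
def LowForSpeed (A : Set (List Bool)) : Prop :=
  ∀ L : Set (List Bool), (ComputablePred fun x => x ∈ L) →
    ∀ (M : OracleTM) (f : List Bool → ℕ), M.DecidesInTime A L f →
      ∃ (M' : OracleTM) (p : Polynomial ℕ),
        M'.OracleFree ∧ M'.DecidesInTime ∅ L fun x => p.eval (f x)

/-- The set of all low for speed oracles. -/
def LFS : Set (Set (List Bool)) := {A | LowForSpeed A}

/-! ### Turing degrees of sets and of languages -/

/-- The position of a string in the length-lexicographic order (the empty string has position `0`):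
the number with binary expansion `1x`, minus one. -/
def strNum (x : List Bool) : ℕ := x.foldl (fun n b => 2 * n + b.toNat) 1 - 1

/-- A language, as a set of natural numbers. -/
def toSet (A : Set (List Bool)) : Set ℕ := strNum '' A

open Classical in
/-- The characteristic function of a set of natural numbers. -/
noncomputable def char (X : Set ℕ) : ℕ →. ℕ := fun n => Part.some (if n ∈ X then 1 else 0)

/-- The Turing degree of a set of natural numbers. -/
noncomputable def deg (X : Set ℕ) : TuringDegree := toAntisymmetrization TuringReducible (char X)

/-- The Turing degrees that contain a low for speed set. -/
def LFSDegrees : Set TuringDegree := {a | ∃ A ∈ LFS, deg (toSet A) = a}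

/-! ### Genericity -/

open Classical in
/-- The prefix of length `n` of the characteristic sequence of `G`. -/
noncomputable def pre (G : Set ℕ) (n : ℕ) : List Bool := (List.range n).map fun i => decide (i ∈ G)

/-- `G` is `1`-generic: for every computably enumerable set `W` of strings, some prefix of `G` is
in `W`, or some prefix of `G` has no extension in `W`. -/
def OneGeneric (G : Set ℕ) : Prop :=
  ∀ W : Set (List Bool), (REPred fun σ => σ ∈ W) →
    (∃ n, pre G n ∈ W) ∨ ∃ n, ∀ τ, pre G n <+: τ → τ ∉ W

/-- The language `{0^(2^n) : n ∈ G}`. -/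
def sparse (G : Set ℕ) : Set (List Bool) := {x | ∃ n ∈ G, x = List.replicate (2 ^ n) false}

end LowSpeed

/-! Let `M` with oracle `sparse G` decide a computable language `L` in time `f`. Call a string `τ`
bad if `M` with oracle `finOracle τ` gives a wrong answer on some input in fewer than `2 ^ τ.length`
steps. As `L` is computable, the bad strings form a c.e. set (`rePred_wrong`). No prefix of `G` is
bad: in so few steps only strings shorter than `2 ^ τ.length` can be queried, and on these the two
oracles agree. So genericity yields a prefix `pre G n₀` without bad extensions: however it is
continued, a short halting run gives the right answer.

A machine without oracle can therefore try, for `m = n₀, n₀ + 1, …`, all guesses of length `m` that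
extend the prefix, run each for `2 ^ m - 1` steps, and return the first output. Sparseness pays
here: such a run depends on `m` bits only, so fewer than `2 ^ (m + 1)` guesses are tried up to stage
`m`. Once `f x < 2 ^ m`, the true prefix of `G` is among the guesses and halts, and the total time
is polynomial in `f x` (`exists_oracleFree_of_forall_extension`).

Since `f x` may be much smaller than the length of `x`, the input cannot be copied. The simulation
runs on the tapes of `M` themselves and is reversible: a history tape records every step, is
replayed backwards after a failed guess, and by its length also serves as the clock (`ready_next`).

The Turing equivalence holds because `0^(2^n)` has the computable position `2 ^ 2 ^ n - 1`. For the
cardinality, the generic sequences form a comeager Borel set, which is uncountable and hence of size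
continuum (`mk_genericSeqs`), and `sparse` is injective. -/

namespace LowSpeed

open Turing

/-! ### Machines with two extra tapes that have their own alphabets -/

/-- A program on tapes `0, …, k` over `Sym Aux` and two further tapes over `Option α` and
`Option β`: every state either halts with an output or carries a transition function. -/
abbrev TwoProgram (k : ℕ) (Aux α β S : Type) : Type :=
  S → Bool ⊕ ((Fin (k + 1) → Sym Aux) → Option α → Option β →
    S × (Fin (k + 1) → Sym Aux × Option Dir) × (Option α × Option Dir) × (Option β × Option Dir))

/-- A configuration of a program with two extra tapes. -/
structure TwoCfg (k : ℕ) (Aux α β S : Type) : Type where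
  state : S
  T : Fin (k + 1) → Tape (Sym Aux)
  O : Tape (Option α)
  H : Tape (Option β)

namespace TwoProgram

variable {k : ℕ} {Aux α β S : Type}

/-- Write a symbol and move the head. -/
def act {Γ : Type} [Inhabited Γ] (T : Tape Γ) (a : Γ × Option Dir) : Tape Γ :=
  OracleTM.shift a.2 (T.write a.1)

/-- One step of a program with two extra tapes. -/
def step (P : TwoProgram k Aux α β S) (c : TwoCfg k Aux α β S) : TwoCfg k Aux α β S :=
  match P c.state with
  | .inl _ => c
  | .inr f =>
      let r := f (fun i => (c.T i).head) c.O.head c.H.head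
      ⟨r.1, fun i => act (c.T i) (r.2.1 i), act c.O r.2.2.1, act c.H r.2.2.2⟩

/-- The embedding of the alphabet of the main tapes. -/
def symT (α β : Type) : PointedMap (Sym Aux) (Sym (Aux ⊕ (α ⊕ β))) :=
  ⟨Option.map (Sum.map id Sum.inl), rfl⟩

/-- The embedding of the alphabet of the first extra tape. -/
def symO (Aux β : Type) : PointedMap (Option α) (Sym (Aux ⊕ (α ⊕ β))) :=
  ⟨Option.map fun a => Sum.inr (Sum.inr (Sum.inl a)), rfl⟩

/-- The embedding of the alphabet of the second extra tape. -/
def symH (Aux α : Type) : PointedMap (Option β) (Sym (Aux ⊕ (α ⊕ β))) :=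
  ⟨Option.map fun b => Sum.inr (Sum.inr (Sum.inr b)), rfl⟩

/-- A left inverse of `symT`. -/
def getT : Sym (Aux ⊕ (α ⊕ β)) → Sym Aux
  | some (.inl b) => some (.inl b)
  | some (.inr (.inl a)) => some (.inr a)
  | _ => none

/-- A left inverse of `symO`. -/
def getO : Sym (Aux ⊕ (α ⊕ β)) → Option α
  | some (.inr (.inr (.inl a))) => some a
  | _ => none

/-- A left inverse of `symH`. -/
def getH : Sym (Aux ⊕ (α ⊕ β)) → Option β
  | some (.inr (.inr (.inr b))) => some b
  | _ => none

theorem getT_symT (s : Sym Aux) : getT (symT α β s) = s := by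
  rcases s with _ | _ | _ <;> rfl

theorem getO_symO (s : Option α) : getO (symO Aux β s) = s := by
  rcases s with _ | _ <;> rfl

theorem getH_symH (s : Option β) : getH (symH Aux α s) = s := by
  rcases s with _ | _ <;> rfl

/-- A function on `k + 3` indices, given by its values on the first `k + 1` and on the last two. -/
def join {X : Type} (t : Fin (k + 1) → X) (o h : X) : Fin (k + 2 + 1) → X :=
  Fin.snoc (α := fun _ => X) (Fin.snoc (α := fun _ => X) t o) h

/-- The index of a main tape. -/
def idxT (i : Fin (k + 1)) : Fin (k + 2 + 1) := i.castSucc.castSucc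

/-- The index of the first extra tape. -/
def idxO : Fin (k + 2 + 1) := (Fin.last (k + 1)).castSucc

/-- The index of the second extra tape. -/
def idxH : Fin (k + 2 + 1) := Fin.last (k + 2)

@[simp] theorem join_idxT {X : Type} (t : Fin (k + 1) → X) (o h : X) (i : Fin (k + 1)) :
    join t o h (idxT i) = t i := by
  unfold join idxT
  rw [Fin.snoc_castSucc, Fin.snoc_castSucc]

@[simp] theorem join_idxO {X : Type} (t : Fin (k + 1) → X) (o h : X) :
    join t o h idxO = o := by
  unfold join idxO
  rw [Fin.snoc_castSucc, Fin.snoc_last]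

@[simp] theorem join_idxH {X : Type} (t : Fin (k + 1) → X) (o h : X) :
    join t o h idxH = h := by
  unfold join idxH
  rw [Fin.snoc_last]

theorem idx_cases {p : Fin (k + 2 + 1) → Prop} (hT : ∀ i, p (idxT i)) (hO : p idxO) (hH : p idxH) :
    ∀ i, p i := by
  intro i
  refine Fin.lastCases hH (fun i => ?_) i
  exact Fin.lastCases (motive := fun i : Fin (k + 2) => p i.castSucc) hO (fun i => hT i) i

/-- The oracle-free Turing machine that runs a program with two extra tapes. -/
abbrev toTM [Finite Aux] [Finite α] [Finite β] [Finite S] (P : TwoProgram k Aux α β S) (start : S) :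
    OracleTM where
  k := k + 2
  Aux := Aux ⊕ (α ⊕ β)
  State := S
  finite_aux := inferInstance
  finite_state := inferInstance
  start := start
  program q :=
    match P q with
    | .inl b => .halt b
    | .inr f => .work fun s =>
        let r := f (fun i => getT (s (idxT i))) (getO (s idxO)) (getH (s idxH))
        (r.1, join (fun i => (symT α β (r.2.1 i).1, (r.2.1 i).2))
          (symO Aux β r.2.2.1.1, r.2.2.1.2) (symH Aux α r.2.2.2.1, r.2.2.2.2))

section

variable [Finite Aux] [Finite α] [Finite β] [Finite S] (P : TwoProgram k Aux α β S) (start : S)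

theorem toTM_oracleFree : (P.toTM start).OracleFree := by
  intro q y n h
  simp only [toTM] at h
  split at h <;> cases h

/-- The configuration of the Turing machine that represents a configuration of the program. -/
def embed (c : TwoCfg k Aux α β S) : (P.toTM start).Cfg where
  state := c.state
  tape := join (fun i => (c.T i).map (symT α β)) (c.O.map (symO Aux β)) (c.H.map (symH Aux α))
  queryTape := []

theorem map_act {Γ Γ' : Type} [Inhabited Γ] [Inhabited Γ'] (f : PointedMap Γ Γ') (T : Tape Γ)
    (a : Γ) (d : Option Dir) :
    OracleTM.shift d ((T.map f).write (f a)) = (act T (a, d)).map f := by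
  cases d with
  | none => exact (Tape.map_write f a T).symm
  | some d =>
    change Tape.move d ((T.map f).write (f a)) = (Tape.move d (T.write a)).map f
    rw [Tape.map_move, Tape.map_write]

/-- The alphabets are embedded with left inverses, so one step of the program is exactly one step of
the machine. -/
theorem step_embed (c : TwoCfg k Aux α β S) :
    (P.toTM start).step ∅ (P.embed start c) = P.embed start (P.step c) := by
  unfold OracleTM.step step
  have hs : (P.embed start c).state = c.state := rfl
  rcases hP : P c.state with b | f
  · have : (P.toTM start).program (P.embed start c).state = .halt b := by
      simp only [toTM, hs, hP]
    rw [this]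
  · have : (P.toTM start).program (P.embed start c).state = .work fun s =>
        let r := f (fun i => getT (s (idxT i))) (getO (s idxO)) (getH (s idxH))
        (r.1, join (fun i => (symT α β (r.2.1 i).1, (r.2.1 i).2))
          (symO Aux β r.2.2.1.1, r.2.2.1.2) (symH Aux α r.2.2.2.1, r.2.2.2.2)) := by
      simp only [toTM, hs, hP]
    rw [this]
    have h1 : (fun i => getT ((P.embed start c).tape (idxT i)).head) = fun i => (c.T i).head := by
      funext i
      change getT ((join _ _ _ (idxT i)) : Tape (Sym (Aux ⊕ (α ⊕ β)))).head = _
      rw [join_idxT, Tape.map_fst, getT_symT]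
    have h2 : getO ((P.embed start c).tape idxO).head = c.O.head := by
      change getO ((join _ _ _ idxO) : Tape (Sym (Aux ⊕ (α ⊕ β)))).head = _
      rw [join_idxO, Tape.map_fst, getO_symO]
    have h3 : getH ((P.embed start c).tape idxH).head = c.H.head := by
      change getH ((join _ _ _ idxH) : Tape (Sym (Aux ⊕ (α ⊕ β)))).head = _
      rw [join_idxH, Tape.map_fst, getH_symH]
    simp only [h1, h2, h3]
    unfold embed
    congr 1
    funext i
    induction i using idx_cases with
    | hT i => rw [join_idxT, join_idxT]; dsimp only; rw [join_idxT]; exact map_act _ _ _ _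
    | hO => rw [join_idxO, join_idxO]; dsimp only; rw [join_idxO]; exact map_act _ _ _ _
    | hH => rw [join_idxH, join_idxH]; dsimp only; rw [join_idxH]; exact map_act _ _ _ _

/-- The initial configuration of a program with two extra tapes, which are empty. -/
def initCfg (x : List Bool) : TwoCfg k Aux α β S :=
  ⟨start, fun i => Tape.mk₁ (if i = 0 then x.map Sym.bit else []), Tape.mk₁ [], Tape.mk₁ []⟩

theorem init_eq_embed (x : List Bool) :
    (P.toTM start).init x = P.embed start (initCfg start x) := by
  unfold OracleTM.init embed initCfg
  congr 1
  funext i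
  revert i
  change ∀ i : Fin (k + 2 + 1), Tape.mk₁ (if i = 0 then _ else _) = _
  intro i
  induction i using idx_cases with
  | hT i =>
    rw [join_idxT, Tape.map_mk₁]
    have : idxT i = 0 ↔ i = 0 :=
      ⟨fun h => Fin.ext (show i.val = 0 from congrArg Fin.val h), fun h => by subst h; rfl⟩
    by_cases hi : i = 0
    · rw [if_pos (this.2 hi), if_pos hi, List.map_map]; rfl
    · rw [if_neg (fun h => hi (this.1 h)), if_neg hi]; rfl
  | hO =>
    rw [join_idxO, Tape.map_mk₁, if_neg fun h => absurd (congrArg Fin.val h) (Nat.succ_ne_zero k)]; rfl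
  | hH =>
    rw [join_idxH, Tape.map_mk₁, if_neg fun h => absurd (congrArg Fin.val h) (Nat.succ_ne_zero (k + 1))]; rfl

theorem haltsWithin_toTM {x : List Bool} {t : ℕ} {b : Bool} {s : ℕ} (hs : s ≤ t)
    (h : P ((P.step^[s] (initCfg start x)).state) = .inl b) :
    (P.toTM start).HaltsWithin ∅ x t b := by
  refine ⟨s, hs, ?_⟩
  have : ∀ s, (P.toTM start).run ∅ x s = P.embed start (P.step^[s] (initCfg start x)) := by
    intro s
    induction s with
    | zero => exact init_eq_embed P start x
    | succ s ih =>
      unfold OracleTM.run at ih ⊢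
      rw [Function.iterate_succ_apply', Function.iterate_succ_apply', ih, step_embed]
  rw [this s]
  simp only [toTM, embed, h]

end
end TwoProgram

open TwoProgram

/-! ### Tapes given by two lists -/

section Tapes

variable {Γ : Type}

theorem ListBlank.mk_append_blank [Inhabited Γ] (l : List Γ) :
    ListBlank.mk (l ++ [default]) = ListBlank.mk l :=
  Quotient.sound' (Or.inr ⟨1, rfl⟩)

theorem mk₂_append_none (l r : List (Option Γ)) : Tape.mk₂ l (r ++ [none]) = Tape.mk₂ l r :=
  congrArg (Tape.mk' _) (ListBlank.mk_append_blank r)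

theorem mk₂_singleton_none (l : List (Option Γ)) : Tape.mk₂ l [none] = Tape.mk₂ l [] :=
  mk₂_append_none l []

theorem mk₂_none_left (r : List (Option Γ)) : Tape.mk₂ [none] r = Tape.mk₂ [] r :=
  congrArg (Tape.mk' · _) (ListBlank.mk_append_blank (Γ := Option Γ) [])

@[simp] theorem act_head {Γ : Type} [Inhabited Γ] (T : Tape Γ) : act T (T.head, none) = T :=
  Tape.write_self T

@[simp] theorem act_mk₂_right (l r : List (Option Γ)) (a b : Option Γ) :
    act (Tape.mk₂ l (a :: r)) (b, some .right) = Tape.mk₂ (b :: l) r := by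
  change Tape.move .right (Tape.mk' (ListBlank.mk l) (ListBlank.mk (b :: r))) = _
  rw [Tape.move_right_mk']; rfl

@[simp] theorem act_mk₂_left (l r : List (Option Γ)) (a b c : Option Γ) :
    act (Tape.mk₂ (c :: l) (a :: r)) (b, some .left) = Tape.mk₂ l (c :: b :: r) := by
  change Tape.move .left (Tape.mk' (ListBlank.mk (c :: l)) (ListBlank.mk (b :: r))) = _
  rw [Tape.move_left_mk']; rfl

@[simp] theorem act_mk₂_nil_left (r : List (Option Γ)) (a b : Option Γ) :
    act (Tape.mk₂ [] (a :: r)) (b, some .left) = Tape.mk₂ [] (none :: b :: r) := by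
  change Tape.move .left (Tape.mk' (ListBlank.mk []) (ListBlank.mk (b :: r))) = _
  rw [Tape.move_left_mk']; rfl

theorem act_mk₂_right_tail (l r : List (Option Γ)) (b : Option Γ) :
    act (Tape.mk₂ l r) (b, some .right) = Tape.mk₂ (b :: l) r.tail := by
  cases r with
  | nil => rw [← mk₂_singleton_none, act_mk₂_right]; rfl
  | cons a r => rw [act_mk₂_right]; rfl

/-- The tape obtained from `Tape.mk₂ l r` by moving the head to the left. -/
def leftOf (l r : List (Option Γ)) : Tape (Option Γ) :=
  match l with
  | [] => Tape.mk₂ [] (none :: r)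
  | a :: l => Tape.mk₂ l (a :: r)

theorem act_mk₂_leftOf (l r : List (Option Γ)) (a b : Option Γ) :
    act (Tape.mk₂ l (a :: r)) (b, some .left) = leftOf l (b :: r) := by
  cases l <;> simp [leftOf]

theorem act_mk₂_nil_leftOf (l : List (Option Γ)) (b : Option Γ) :
    act (Tape.mk₂ l []) (b, some .left) = leftOf l [b] := by
  rw [← mk₂_singleton_none, act_mk₂_leftOf]

/-- The opposite of a head movement. -/
def invDir : Option Dir → Option Dir
  | none => none
  | some .left => some .right
  | some .right => some .left

/-- A step writes and then moves; it is inverted by moving back and then restoring the overwritten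
symbol. This makes the simulation reversible. -/
theorem act_invDir [Inhabited Γ] (T : Tape Γ) (a : Γ) (d : Option Dir) :
    act (act (act T (a, d)) ((act T (a, d)).head, invDir d)) (T.head, none) = T := by
  have key : ∀ T' : Tape Γ, act T' (T'.head, invDir d) = OracleTM.shift (invDir d) T' := by
    intro T'
    unfold act
    rw [Tape.write_self]
  rw [key]
  have h : OracleTM.shift (invDir d) (act T (a, d)) = T.write a := by
    rcases d with _ | _ | _
    · rfl
    · exact Tape.move_left_right (T.write a)
    · exact Tape.move_right_left (T.write a)
  rw [h]
  rfl

end Tapes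

/-! ### Reaching a configuration within a number of steps -/

namespace TwoProgram

variable {k : ℕ} {Aux α β S : Type} (P : TwoProgram k Aux α β S)

/-- `P` leads from `c` to `c'` in at most `B` steps. -/
def Within (B : ℕ) (c c' : TwoCfg k Aux α β S) : Prop :=
  ∃ n ≤ B, P.step^[n] c = c'

/-- `P`, started in `c`, halts with output `b` after at most `B` steps. -/
def HaltsIn (B : ℕ) (c : TwoCfg k Aux α β S) (b : Bool) : Prop :=
  ∃ n ≤ B, P (P.step^[n] c).state = .inl b

variable {P}

theorem Within.refl (B : ℕ) (c : TwoCfg k Aux α β S) : P.Within B c c :=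
  ⟨0, Nat.zero_le _, rfl⟩

theorem Within.single {c c' : TwoCfg k Aux α β S} (h : P.step c = c') : P.Within 1 c c' :=
  ⟨1, le_rfl, h⟩

theorem Within.trans {B B' : ℕ} {c c' c'' : TwoCfg k Aux α β S} (h : P.Within B c c')
    (h' : P.Within B' c' c'') : P.Within (B + B') c c'' := by
  obtain ⟨n, hn, rfl⟩ := h
  obtain ⟨m, hm, rfl⟩ := h'
  exact ⟨m + n, by omega, Function.iterate_add_apply _ _ _ _⟩

theorem Within.mono {B B' : ℕ} {c c' : TwoCfg k Aux α β S} (h : P.Within B c c') (hB : B ≤ B') :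
    P.Within B' c c' := by
  obtain ⟨n, hn, e⟩ := h
  exact ⟨n, hn.trans hB, e⟩

theorem Within.head {B : ℕ} {c c' c'' : TwoCfg k Aux α β S} (h : P.step c = c')
    (h' : P.Within B c' c'') : P.Within (B + 1) c c'' :=
  ((Within.single h).trans h').mono (by omega)

theorem Within.tail {B : ℕ} {c c' c'' : TwoCfg k Aux α β S} (h : P.Within B c c')
    (h' : P.step c' = c'') : P.Within (B + 1) c c'' :=
  h.trans (.single h')

theorem HaltsIn.of_within {B B' : ℕ} {c c' : TwoCfg k Aux α β S} {b : Bool} (h : P.Within B c c')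
    (h' : P.HaltsIn B' c' b) : P.HaltsIn (B + B') c b := by
  obtain ⟨n, hn, rfl⟩ := h
  obtain ⟨m, hm, e⟩ := h'
  exact ⟨m + n, by omega, by rwa [Function.iterate_add_apply]⟩

theorem HaltsIn.mono {B B' : ℕ} {c : TwoCfg k Aux α β S} {b : Bool} (h : P.HaltsIn B c b)
    (hB : B ≤ B') : P.HaltsIn B' c b := by
  obtain ⟨n, hn, e⟩ := h
  exact ⟨n, hn.trans hB, e⟩

end TwoProgram
/-! ### The simulating machine -/

/-- Symbols of the oracle tape: the left end, a bit that is fixed, and a bit that is guessed. -/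
inductive Cell : Type
  | start
  | fix (b : Bool)
  | free (b : Bool)

namespace Cell

instance : Finite Cell :=
  Finite.of_injective (β := Option (Bool × Bool))
    (fun c => match c with
      | start => none
      | fix b => some (false, b)
      | free b => some (true, b))
    (by rintro (_ | _ | _) (_ | _ | _) h <;> simp_all)

/-- The bit in a cell. -/
def bit : Cell → Bool
  | start => false
  | fix b => b
  | free b => b

/-- Replace a guessed bit by `false`. -/
def reset : Cell → Cell
  | free _ => free false
  | c => c

end Cell

/-- The next guess: increment the binary counter that consists of the free cells. -/
def incr : List Cell → Option (List Cell)
  | [] => none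
  | .free false :: w => some (.free true :: w)
  | c :: w => (incr w).map (c.reset :: ·)

/-- The word of the next length: one free cell is appended, and then fixed zeros. -/
def extend (w : List Cell) : List Cell :=
  w.map Cell.reset ++ .free false :: List.replicate (w.length - 1) (.fix false)

/-- The word that is tried after `w`. -/
def nextWord (w : List Cell) : List Cell :=
  (incr w).getD (extend w)

/-- What is remembered of a step: on each tape the symbol that was overwritten, if any, and the
movement of the head. -/
abbrev Record (k : ℕ) (Aux : Type) : Type := Fin (k + 1) → Option (Sym Aux) × Option Dir

/-- The record of a step that does not touch the tapes. -/
def mark {k : ℕ} {Aux : Type} : Record k Aux := fun _ => (none, none)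

/-- States of the simulating machine; `Q` is the set of states of the simulated machine. -/
inductive SimState (Q : Type) (N : ℕ) : Type
  | init (i : Fin (N + 1))
  | fill
  | sim (q : Q) (flag : Bool)
  | rewSim (q : Q)
  | rewInc
  | rewUndo
  | inc
  | undo (ext : Bool)
  | undoW (ext : Bool)

instance : Finite Dir :=
  Finite.of_injective (β := Bool) (fun d => match d with | .left => true | .right => false)
    (by rintro (_ | _) (_ | _) h <;> simp_all)

instance {Q : Type} [Finite Q] {N : ℕ} : Finite (SimState Q N) :=
  Finite.of_injective (β := Fin (N + 1) ⊕ (Q × Bool) ⊕ Q ⊕ Fin 4 ⊕ Bool ⊕ Bool)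
    (fun s => match s with
      | .init i => .inl i
      | .sim q b => .inr (.inl (q, b))
      | .rewSim q => .inr (.inr (.inl q))
      | .fill => .inr (.inr (.inr (.inl 0)))
      | .rewInc => .inr (.inr (.inr (.inl 1)))
      | .rewUndo => .inr (.inr (.inr (.inl 2)))
      | .inc => .inr (.inr (.inr (.inl 3)))
      | .undo b => .inr (.inr (.inr (.inr (.inl b))))
      | .undoW b => .inr (.inr (.inr (.inr (.inr b)))))
    (by intro s t h; cases s <;> cases t <;> simp_all)

/-- Leave all tapes as they are. -/
def keep {k : ℕ} {Aux : Type} (s : Fin (k + 1) → Sym Aux) : Fin (k + 1) → Sym Aux × Option Dir :=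
  fun i => (s i, none)

/-- The program that simulates `M` with guessed oracles. The first extra tape carries the guessed
oracle, the second one the history of the simulation, whose length limits the number of steps. -/
def simulator (M : OracleTM) (w : List Cell) :
    TwoProgram M.k M.Aux Cell (Record M.k M.Aux) (SimState M.State w.length)
  | .init i => .inr fun s o h =>
      if hi : i.val < w.length then
        (.init ⟨i + 1, by omega⟩, keep s, (some w[i.val], some .right), (h, none))
      else (.fill, keep s, (o, some .left), (h, none))
  -- One mark is written for every oracle cell except the end marker, which sets the clock to one
  -- less than the length of the word.
  | .fill => .inr fun s o h =>
      match o with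
      | some .start => (.undo false, keep s, (o, none), (h, some .left))
      | _ => (.fill, keep s, (o, some .left), (some mark, some .right))
  -- The flag says that the current query has no 1 so far. In that case the oracle head stands on
  -- the cell whose position is the length of the query, so the scanned bit is the answer. A blank
  -- history cell means that time is up; halting is tested before that.
  | .sim q flag =>
      match M.program q with
      | .halt b => .inl b
      | .work f => .inr fun s o h =>
          match h with
          | none => (.rewInc, keep s, (o, none), (h, none))
          | some _ => (.sim (f s).1 flag, (f s).2, (o, none),
              (some fun i => (some (s i), ((f s).2 i).2), some .right))
      | .append b q' => .inr fun s o h =>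
          match h with
          | none => (.rewInc, keep s, (o, none), (h, none))
          | some _ => (.sim q' (flag && !b), keep s, (o, if flag && !b then some .right else none),
              (some mark, some .right))
      | .query y n => .inr fun s o h =>
          match h with
          | none => (.rewInc, keep s, (o, none), (h, none))
          | some _ => (.rewSim (if flag && (o.map Cell.bit).getD false then y else n), keep s,
              (o, none), (some mark, some .right))
  | .rewSim q => .inr fun s o h =>
      match o with
      | some .start => (.sim q true, keep s, (o, none), (h, none))
      | _ => (.rewSim q, keep s, (o, some .left), (h, none))
  | .rewInc => .inr fun s o h =>
      match o with
      | some .start => (.inc, keep s, (o, none), (h, none))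
      | _ => (.rewInc, keep s, (o, some .left), (h, none))
  | .rewUndo => .inr fun s o h =>
      match o with
      | some .start => (.undo false, keep s, (o, none), (h, some .left))
      | _ => (.rewUndo, keep s, (o, some .left), (h, none))
  -- The blank after the word is reached only if the counter overflows; then `ext` is set and the
  -- word doubles its length.
  | .inc => .inr fun s o h =>
      match o with
      | none => (.undo true, keep s, (some (.free false), some .right), (h, some .left))
      | some (.free false) => (.rewUndo, keep s, (some (.free true), none), (h, none))
      | some c => (.inc, keep s, (some c.reset, some .right), (h, none))
  | .undo ext => .inr fun s o h =>
      match h with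
      | some r => (.undoW ext, fun i => (s i, invDir (r i).2), (o, none), (h, none))
      | none =>
          if ext then (.fill, keep s, (o, some .left), (h, some .right))
          else (.sim M.start true, keep s, (o, none), (h, some .right))
  -- With `ext`, each undone record also contributes one zero. A full run leaves one record less
  -- than the length of the word, exactly the number of zeros that `extend` appends.
  | .undoW ext => .inr fun s o h =>
      (.undo ext, fun i => (((h.map fun r => (r i).1).join).getD (s i), none),
        if ext then (some (.fix false), some .right) else (o, none), (some mark, some .left))

/-- The configurations of the simulator. -/
abbrev SimCfg (M : OracleTM) (w : List Cell) : Type :=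
  TwoCfg M.k M.Aux Cell (Record M.k M.Aux) (SimState M.State w.length)

/-- The tape on which `l.reverse ++ r` is written, with the head on the first symbol of `r`. -/
def zip {Γ : Type} (l r : List Γ) : Tape (Option Γ) := Tape.mk₂ (l.map some) (r.map some)

/-- The tape `zip l r` after a movement to the left. -/
def zipLeft {Γ : Type} (l r : List Γ) : Tape (Option Γ) := leftOf (l.map some) (r.map some)

/-! ### Tapes on which a word without blanks is written -/

section Zip

variable {Γ : Type} (l r : List Γ) (a b c : Γ)

@[simp] theorem zip_head_cons : (zip l (a :: r)).head = some a := rfl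

@[simp] theorem zip_head_nil : (zip l []).head = none := rfl

@[simp] theorem act_zip_stay_nil : act (zip l []) (none, none) = zip l [] :=
  act_head (zip l [])

@[simp] theorem act_zip_stay : act (zip l (a :: r)) (some b, none) = zip l (b :: r) := rfl

@[simp] theorem act_zip_right : act (zip l r) (some b, some .right) = zip (b :: l) r.tail := by
  unfold zip
  rw [act_mk₂_right_tail, List.map_tail]; rfl

@[simp] theorem act_zip_left :
    act (zip (c :: l) (a :: r)) (some b, some .left) = zip l (c :: b :: r) := by
  simp [zip]

@[simp] theorem act_zip_left_nil : act (zip l []) (none, some .left) = zipLeft l [] := by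
  unfold zip zipLeft
  rw [List.map_nil, act_mk₂_nil_leftOf]
  cases l with
  | nil =>
    change Tape.mk₂ [] ([none] ++ [none]) = Tape.mk₂ [] [none]
    rw [mk₂_append_none]
  | cons a l =>
    change Tape.mk₂ _ ([some a] ++ [none]) = Tape.mk₂ _ [some a]
    rw [mk₂_append_none]

theorem act_zip_zipLeft : act (zip l (a :: r)) (some b, some .left) = zipLeft l (b :: r) := by
  simp [zip, zipLeft, act_mk₂_leftOf]

@[simp] theorem zipLeft_cons : zipLeft (a :: l) r = zip l (a :: r) := rfl

@[simp] theorem zipLeft_nil_head : (zipLeft [] r).head = none := rfl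

@[simp] theorem act_zipLeft_nil : act (zipLeft [] r) (none, some .right) = zip [] r := by
  simp [zipLeft, leftOf, zip, mk₂_none_left]

end Zip

theorem replicate_succ_append {Γ : Type} (n : ℕ) (a : Γ) (l : List Γ) :
    List.replicate (n + 1) a ++ l = List.replicate n a ++ a :: l := by
  simp [List.replicate_succ']

/-! ### Loops of the simulator: filling, rewinding, counting, undoing -/

section Loops

variable {M : OracleTM} {w : List Cell} (T : Fin (M.k + 1) → Tape (Sym M.Aux))

theorem act_keep (i : Fin (M.k + 1)) : act (T i) (keep (fun i => (T i).head) i) = T i :=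
  act_head _

/-- A word that begins with the left end marker and does not contain it elsewhere. -/
def Marked (w : List Cell) : Prop := ∃ u, w = .start :: u ∧ .start ∉ u

/-- The end marker is unique, so a loop that moves left does not stop too early. -/
theorem Marked.ne_start {l r : List Cell} {a c : Cell} (h : Marked ((a :: l).reverse ++ c :: r)) :
    c ≠ .start := by
  obtain ⟨u, hu, hs⟩ := h
  rintro rfl
  apply hs
  rw [List.reverse_cons, List.append_assoc] at hu
  cases hl : l.reverse with
  | nil => rw [hl] at hu; simp only [List.nil_append, List.cons_append, List.cons.injEq] at hu
           rw [← hu.2]; simp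
  | cons b l' => rw [hl] at hu; simp only [List.nil_append, List.cons_append, List.cons.injEq] at hu
                 rw [← hu.2]; simp

theorem fill_loop (l r : List Cell) (hl hr : List (Record M.k M.Aux))
    (hr0 : r ≠ []) (hm : Marked (l.reverse ++ r)) :
    (simulator M w).Within l.length ⟨.fill, T, zip l r, zip hl hr⟩
      ⟨.fill, T, zip [] (l.reverse ++ r), zip (List.replicate l.length mark ++ hl)
        (hr.drop l.length)⟩ := by
  induction l generalizing r hl hr with
  | nil => exact Within.refl _ _
  | cons a l ih =>
    obtain ⟨c, r, rfl⟩ := List.exists_cons_of_ne_nil hr0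
    have hc : c ≠ .start := hm.ne_start
    have h1 : (simulator M w).step ⟨.fill, T, zip (a :: l) (c :: r), zip hl hr⟩ =
        ⟨.fill, T, zip l (a :: c :: r), zip (mark :: hl) hr.tail⟩ := by
      rcases c with _ | b | b
      · exact absurd rfl hc
      all_goals simp [TwoProgram.step, simulator, act_keep]
    rw [List.reverse_cons, List.append_assoc] at hm ⊢
    have h2 := (ih (a :: c :: r) (mark :: hl) hr.tail (by simp) hm).head h1
    rw [List.length_cons, replicate_succ_append, ← List.drop_tail]
    exact h2

/-- A loop that moves the head of the oracle tape back to the left end. -/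
theorem rewind_loop {q : SimState M.State w.length} {H : Tape (Option (Record M.k M.Aux))}
    (hq : ∀ l r a c, c ≠ Cell.start →
      (simulator M w).step ⟨q, T, zip (a :: l) (c :: r), H⟩ = ⟨q, T, zip l (a :: c :: r), H⟩)
    (l r : List Cell) (hr0 : r ≠ []) (hm : Marked (l.reverse ++ r)) :
    (simulator M w).Within l.length ⟨q, T, zip l r, H⟩ ⟨q, T, zip [] (l.reverse ++ r), H⟩ := by
  induction l generalizing r with
  | nil => exact Within.refl _ _
  | cons a l ih =>
    obtain ⟨c, r, rfl⟩ := List.exists_cons_of_ne_nil hr0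
    have h1 := hq l r a c hm.ne_start
    rw [List.reverse_cons, List.append_assoc] at hm ⊢
    exact (ih (a :: c :: r) (by simp) hm).head h1

theorem rewSim_loop (q : M.State) (H : Tape (Option (Record M.k M.Aux))) (l r : List Cell)
    (hr0 : r ≠ []) (hm : Marked (l.reverse ++ r)) :
    (simulator M w).Within (l.length + 1) ⟨.rewSim q, T, zip l r, H⟩
      ⟨.sim q true, T, zip [] (l.reverse ++ r), H⟩ := by
  refine (rewind_loop T (fun l r a c hc => ?_) l r hr0 hm).tail ?_
  · rcases c with _ | b | b
    · exact absurd rfl hc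
    all_goals simp [TwoProgram.step, simulator, act_keep]
  · obtain ⟨u, hu, -⟩ := hm
    rw [hu]
    simp [TwoProgram.step, simulator, act_keep]

theorem rewInc_loop (H : Tape (Option (Record M.k M.Aux))) (l r : List Cell)
    (hr0 : r ≠ []) (hm : Marked (l.reverse ++ r)) :
    (simulator M w).Within (l.length + 1) ⟨.rewInc, T, zip l r, H⟩
      ⟨.inc, T, zip [] (l.reverse ++ r), H⟩ := by
  refine (rewind_loop T (fun l r a c hc => ?_) l r hr0 hm).tail ?_
  · rcases c with _ | b | b
    · exact absurd rfl hc
    all_goals simp [TwoProgram.step, simulator, act_keep]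
  · obtain ⟨u, hu, -⟩ := hm
    rw [hu]
    simp [TwoProgram.step, simulator, act_keep]

theorem rewUndo_loop (hl : List (Record M.k M.Aux)) (l r : List Cell)
    (hr0 : r ≠ []) (hm : Marked (l.reverse ++ r)) :
    (simulator M w).Within (l.length + 1) ⟨.rewUndo, T, zip l r, zip hl []⟩
      ⟨.undo false, T, zip [] (l.reverse ++ r), zipLeft hl []⟩ := by
  refine (rewind_loop T (fun l r a c hc => ?_) l r hr0 hm).tail ?_
  · rcases c with _ | b | b
    · exact absurd rfl hc
    all_goals simp [TwoProgram.step, simulator, act_keep]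
  · obtain ⟨u, hu, -⟩ := hm
    rw [hu]
    simp [TwoProgram.step, simulator, act_keep]

theorem inc_loop_none (l r : List Cell) (H : Tape (Option (Record M.k M.Aux)))
    (h : incr r = none) :
    (simulator M w).Within r.length ⟨.inc, T, zip l r, H⟩
      ⟨.inc, T, zip ((r.map Cell.reset).reverse ++ l) [], H⟩ := by
  induction r generalizing l with
  | nil => exact Within.refl _ _
  | cons c r ih =>
    have hc : incr r = none ∧ (simulator M w).step ⟨.inc, T, zip l (c :: r), H⟩ =
        ⟨.inc, T, zip (c.reset :: l) r, H⟩ := by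
      rcases c with _ | b | _ | _ <;>
        first
        | simp [incr] at h; done
        | exact ⟨by simpa [incr] using h, by simp [TwoProgram.step, simulator, act_keep]⟩
    refine ((ih (c.reset :: l) hc.1).head hc.2).mono le_rfl |> fun h => ?_
    simpa using h

/-- The head stops at the cell that was incremented. Where this happens is irrelevant, since the
word is rewound next; hence the existential split. -/
theorem inc_loop_some (l r r' : List Cell) (H : Tape (Option (Record M.k M.Aux)))
    (h : incr r = some r') :
    ∃ l₁ r₁, l₁.reverse ++ r₁ = l.reverse ++ r' ∧ r₁ ≠ [] ∧
      (simulator M w).Within r.length ⟨.inc, T, zip l r, H⟩ ⟨.rewUndo, T, zip l₁ r₁, H⟩ := by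
  induction r generalizing l r' with
  | nil => simp [incr] at h
  | cons c r ih =>
    by_cases hc : c = .free false
    · subst hc
      simp only [incr, Option.some.injEq] at h
      subst h
      refine ⟨l, _, rfl, by simp, (Within.single ?_).mono (by simp)⟩
      simp [TwoProgram.step, simulator, act_keep]
    · have hc' : (incr r).map (c.reset :: ·) = some r' ∧
          (simulator M w).step ⟨.inc, T, zip l (c :: r), H⟩ =
            ⟨.inc, T, zip (c.reset :: l) r, H⟩ := by
        rcases c with _ | b | _ | _ <;>
          first
          | exact absurd rfl hc
          | exact ⟨by simpa [incr] using h, by simp [TwoProgram.step, simulator, act_keep]⟩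
      obtain ⟨r'', hr'', rfl⟩ := Option.map_eq_some_iff.1 hc'.1
      obtain ⟨l₁, r₁, e, hne, hw⟩ := ih (c.reset :: l) r'' hr''
      exact ⟨l₁, r₁, by simpa using e, hne, hw.head hc'.2⟩

/-- Undo a step on one tape. -/
def undoTape {Γ : Type} [Inhabited Γ] (r : Option Γ × Option Dir) (T : Tape Γ) : Tape Γ :=
  let T' := act T (T.head, invDir r.2)
  act T' (r.1.getD T'.head, none)

/-- Undo a step. -/
def undoStep (T : Fin (M.k + 1) → Tape (Sym M.Aux)) (r : Record M.k M.Aux) :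
    Fin (M.k + 1) → Tape (Sym M.Aux) :=
  fun i => undoTape (r i) (T i)

theorem undoStep_mark : undoStep T mark = T := by
  funext i
  simp [undoStep, undoTape, mark, invDir]

theorem undoStep_act (f : Fin (M.k + 1) → Sym M.Aux × Option Dir) :
    undoStep (fun i => act (T i) (f i)) (fun i => (some (T i).head, (f i).2)) = T := by
  funext i
  exact act_invDir (T i) (f i).1 (f i).2

theorem undo_two_steps (O : Tape (Option Cell)) (ext : Bool) (r : Record M.k M.Aux)
    (hl hr : List (Record M.k M.Aux)) :
    (simulator M w).step ((simulator M w).step ⟨.undo ext, T, O, zip hl (r :: hr)⟩) =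
      ⟨.undo ext, undoStep T r, if ext then act O (some (.fix false), some .right) else O,
        zipLeft hl (mark :: hr)⟩ := by
  simp [TwoProgram.step, simulator, act_zip_zipLeft]
  refine ⟨?_, ?_⟩
  · funext i
    simp [undoStep, undoTape]
  · cases ext <;> simp

/-- The latest record comes first in `hl`, so the fold undoes the steps in reverse order. The
records become marks again, which resets the clock. -/
theorem undo_loop (O : Tape (Option Cell)) (hl hr : List (Record M.k M.Aux)) :
    (simulator M w).Within (2 * hl.length) ⟨.undo false, T, O, zipLeft hl hr⟩
      ⟨.undo false, hl.foldl undoStep T, O,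
        zipLeft [] (List.replicate hl.length mark ++ hr)⟩ := by
  induction hl generalizing T hr with
  | nil => exact Within.refl _ _
  | cons r hl ih =>
    have h1 := undo_two_steps (w := w) T O false r hl hr
    have h2 := ((ih (undoStep T r) (mark :: hr)).head h1).head rfl
    rw [zipLeft_cons, List.length_cons, replicate_succ_append]
    exact h2

theorem undo_loop_ext (l : List Cell) (hl hr : List (Record M.k M.Aux)) :
    (simulator M w).Within (2 * hl.length) ⟨.undo true, T, zip l [], zipLeft hl hr⟩
      ⟨.undo true, hl.foldl undoStep T, zip (List.replicate hl.length (.fix false) ++ l) [],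
        zipLeft [] (List.replicate hl.length mark ++ hr)⟩ := by
  induction hl generalizing T l hr with
  | nil => exact Within.refl _ _
  | cons r hl ih =>
    have h1 := undo_two_steps (w := w) T (zip l []) true r hl hr
    simp only [if_true, act_zip_right, List.tail_nil] at h1
    have h2 := ((ih (undoStep T r) (.fix false :: l) (mark :: hr)).head h1).head rfl
    rw [zipLeft_cons, List.length_cons, replicate_succ_append, replicate_succ_append]
    exact h2

end Loops
/-- The oracle that is described by a word. -/
def wordOracle (v : List Cell) : Set (List Bool) :=
  {x | ∃ j, x = List.replicate j false ∧ (v[j]?.map Cell.bit).getD false = true}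

theorem replicate_mem_wordOracle {v : List Cell} {j : ℕ} :
    List.replicate j false ∈ wordOracle v ↔ (v[j]?.map Cell.bit).getD false = true := by
  constructor
  · rintro ⟨i, hi, h⟩
    have : j = i := by simpa using congrArg List.length hi
    rwa [this]
  · exact fun h => ⟨j, rfl, h⟩

theorem notMem_wordOracle {v : List Cell} {x : List Bool} (hx : true ∈ x) : x ∉ wordOracle v := by
  rintro ⟨j, rfl, -⟩
  simp at hx

/-! ### One attempt: simulation, halting, passage to the next guess -/

section Simulation

variable {M : OracleTM} {w : List Cell}

/-- The simulator has simulated `n` steps of `M` with the oracle that `v` describes, has arrived at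
the configuration `c`, and the oracle tape is `zip l r`. -/
structure SimInv (v : List Cell) (T₀ : Fin (M.k + 1) → Tape (Sym M.Aux)) (n : ℕ) (c : M.Cfg)
    (l r : List Cell) (flag : Bool) (hist : List (Record M.k M.Aux)) : Prop where
  word : l.reverse ++ r = v
  pos : l.length ≤ n
  zeros : flag = true → c.queryTape = List.replicate l.length false
  nonzeros : flag = false → true ∈ c.queryTape
  hist_length : hist.length = n
  undo : hist.foldl undoStep c.tape = T₀

/-- The configuration of the simulator in a state of the simulation. -/
def simCfg (w : List Cell) (H : ℕ) (n : ℕ) (c : M.Cfg) (l r : List Cell) (flag : Bool)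
    (hist : List (Record M.k M.Aux)) : SimCfg M w :=
  ⟨.sim c.state flag, c.tape, zip l r, zip hist (List.replicate (H - n) mark)⟩

/-- The oracle head advances at most once per step of `M`, so `I.pos` and `hn` keep it on the word.
Queries are the only expensive steps: they rewind the oracle tape. -/
theorem sim_step {v : List Cell} (hv : Marked v) {T₀ : Fin (M.k + 1) → Tape (Sym M.Aux)} {n : ℕ}
    {c : M.Cfg} {l r : List Cell} {flag : Bool} {hist : List (Record M.k M.Aux)}
    (I : SimInv v T₀ n c l r flag hist) (hn : n < v.length - 1)
    (hc : ∀ b, M.program c.state ≠ .halt b) :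
    ∃ l' r' flag' hist', SimInv v T₀ (n + 1) (M.step (wordOracle v) c) l' r' flag' hist' ∧
      (simulator M w).Within (v.length + 1) (simCfg w (v.length - 1) n c l r flag hist)
        (simCfg w (v.length - 1) (n + 1) (M.step (wordOracle v) c) l' r' flag' hist') := by
  obtain ⟨m, hm⟩ : ∃ m, v.length - 1 - n = m + 1 := ⟨v.length - 1 - n - 1, by omega⟩
  have hm' : v.length - 1 - (n + 1) = m := by omega
  have hlen : l.length + r.length = v.length := by rw [← I.word]; simp
  obtain ⟨a, r, rfl⟩ : ∃ a r', r = a :: r' := by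
    refine List.exists_cons_of_ne_nil fun h => ?_
    rw [h] at hlen
    have := I.pos
    simp at hlen; omega
  have hpos := I.pos
  unfold simCfg
  rw [hm, hm', List.replicate_succ]
  rcases hp : M.program c.state with b | f | ⟨b, q⟩ | ⟨y, n'⟩
  · exact absurd hp (hc b)
  · have hs : M.step (wordOracle v) c =
        ⟨(f fun i => (c.tape i).head).1,
          fun i => act (c.tape i) ((f fun i => (c.tape i).head).2 i), c.queryTape⟩ := by
      simp only [OracleTM.step, hp]; rfl
    rw [hs]
    refine ⟨l, a :: r, flag,
      (fun i => (some (c.tape i).head, ((f fun i => (c.tape i).head).2 i).2)) :: hist,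
      ⟨I.word, by omega, I.zeros, I.nonzeros, by simp [I.hist_length], ?_⟩, ?_⟩
    · rw [List.foldl_cons, undoStep_act]; exact I.undo
    · refine (Within.single ?_).mono (Nat.le_add_left _ _)
      simp [TwoProgram.step, simulator, hp]
  · have hs : M.step (wordOracle v) c = ⟨q, c.tape, c.queryTape ++ [b]⟩ := by
      simp only [OracleTM.step, hp]
    rw [hs]
    cases hfl : flag && !b with
    | true =>
      obtain ⟨rfl, hb⟩ : flag = true ∧ b = false := by simpa using hfl
      subst hb
      refine ⟨a :: l, r, true, mark :: hist, ⟨by simpa using I.word, by simpa using I.pos,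
        fun _ => ?_, by simp, by simp [I.hist_length], ?_⟩, ?_⟩
      · rw [I.zeros rfl, List.length_cons, List.replicate_succ']
      · rw [List.foldl_cons, undoStep_mark]; exact I.undo
      · refine (Within.single ?_).mono (Nat.le_add_left _ _)
        simp [TwoProgram.step, simulator, hp, act_keep]
    | false =>
      refine ⟨l, a :: r, false, mark :: hist, ⟨I.word, by omega,
        by simp, fun _ => ?_, by simp [I.hist_length], ?_⟩, ?_⟩
      · cases flag with
        | false => exact List.mem_append_left _ (I.nonzeros rfl)
        | true => simp at hfl; simp [hfl]
      · rw [List.foldl_cons, undoStep_mark]; exact I.undo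
      · refine (Within.single ?_).mono (Nat.le_add_left _ _)
        simp [TwoProgram.step, simulator, hp, act_keep, hfl]
  -- With the flag set, the query is `0^l.length` and the scanned cell is number `l.length`;
  -- otherwise the query contains a 1 and is in no word oracle.
  · have hans : (flag && a.bit) = true ↔ c.queryTape ∈ wordOracle v := by
      cases flag with
      | false => simpa using notMem_wordOracle (I.nonzeros rfl)
      | true =>
        rw [I.zeros rfl, replicate_mem_wordOracle, ← I.word]
        simp
    have hs : M.step (wordOracle v) c = ⟨if flag && a.bit then y else n', c.tape, []⟩ := by
      simp only [OracleTM.step, hp]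
      by_cases hq : c.queryTape ∈ wordOracle v
      · rw [if_pos hq, if_pos (hans.2 hq)]
      · rw [if_neg hq, if_neg fun h => hq (hans.1 h)]
    rw [hs]
    refine ⟨[], v, true, mark :: hist, ⟨rfl, by simp, by simp, by simp,
      by simp [I.hist_length], ?_⟩, ?_⟩
    · rw [List.foldl_cons, undoStep_mark]; exact I.undo
    · have h1 := rewSim_loop (w := w) c.tape (if flag && a.bit then y else n')
        (zip (mark :: hist) (List.replicate m mark)) l (a :: r) (by simp) (by rwa [I.word])
      rw [I.word] at h1
      refine (h1.head ?_).mono (by simp at hlen; omega)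
      simp [TwoProgram.step, simulator, hp, act_keep]
      congr

theorem simulator_halt {q : M.State} {b : Bool} (h : M.program q = .halt b) (flag : Bool) :
    simulator M w (.sim q flag) = .inl b := by
  simp [simulator, h]

theorem sim_loop {v : List Cell} (hv : Marked v) (x : List Bool) (n : ℕ)
    (hn : n ≤ v.length - 1)
    (hh : ∀ s < n, ∀ b, M.program (M.run (wordOracle v) x s).state ≠ .halt b) :
    ∃ l r flag hist, SimInv v (M.init x).tape n (M.run (wordOracle v) x n) l r flag hist ∧
      (simulator M w).Within (n * (v.length + 1))
        (simCfg w (v.length - 1) 0 (M.init x) [] v true [])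
        (simCfg w (v.length - 1) n (M.run (wordOracle v) x n) l r flag hist) := by
  induction n with
  | zero =>
    exact ⟨[], v, true, [], ⟨rfl, le_rfl, fun _ => rfl, by simp, rfl, rfl⟩, Within.refl _ _⟩
  | succ n ih =>
    obtain ⟨l, r, flag, hist, I, hw⟩ := ih (by omega) fun s hs => hh s (by omega)
    obtain ⟨l', r', flag', hist', I', hw'⟩ :=
      sim_step (w := w) hv I (by omega) (hh n (by omega))
    refine ⟨l', r', flag', hist', ?_, ?_⟩
    · unfold OracleTM.run at I' ⊢
      rwa [Function.iterate_succ_apply']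
    · unfold OracleTM.run at hw' hw ⊢
      rw [Function.iterate_succ_apply', Nat.succ_mul]
      exact hw.trans hw'

/-- The configuration of the simulator before the word `v` is tried. -/
def ready (M : OracleTM) (w : List Cell) (x : List Bool) (v : List Cell) : SimCfg M w :=
  simCfg w (v.length - 1) 0 (M.init x) [] v true []

/-- The run is followed up to the first halting time, because `sim_loop` needs that `M` has not
halted before; `b'` is the output found there. -/
theorem ready_halts {v : List Cell} (hv : Marked v) {x : List Bool} {t : ℕ} {b : Bool}
    (ht : t ≤ v.length - 1) (h : M.HaltsWithin (wordOracle v) x t b) :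
    ∃ b', M.HaltsWithin (wordOracle v) x t b' ∧
      (simulator M w).HaltsIn (v.length * (v.length + 1)) (ready M w x v) b' := by
  classical
  have hex : ∃ s, ∃ b, M.program (M.run (wordOracle v) x s).state = .halt b :=
    ⟨_, b, h.choose_spec.2⟩
  obtain ⟨s, hst, hs⟩ := h
  obtain ⟨b', hb'⟩ := Nat.find_spec hex
  have hle : Nat.find hex ≤ s := Nat.find_min' hex ⟨b, hs⟩
  refine ⟨b', ⟨_, hle.trans hst, hb'⟩, ?_⟩
  obtain ⟨l, r, flag, hist, -, hw⟩ := sim_loop (w := w) hv x (Nat.find hex) (by omega)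
    fun s hs b hb => Nat.find_min hex hs ⟨b, hb⟩
  refine (HaltsIn.of_within hw (B' := 0) ⟨0, le_rfl, simulator_halt hb' _⟩).mono ?_
  exact Nat.mul_le_mul_right _ (by omega)

theorem Marked.ne_nil {v : List Cell} (hv : Marked v) : v ≠ [] := by
  obtain ⟨u, rfl, -⟩ := hv
  simp

theorem reset_eq_start {c : Cell} : c.reset = .start ↔ c = .start := by
  cases c <;> simp [Cell.reset]

/-- Words with equal images under `reset` have the same shape: they differ only in guessed bits.
This relation is the invariant for the words of one length. -/
theorem Marked.of_map_reset {v v' : List Cell} (hv : Marked v)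
    (h : v'.map Cell.reset = v.map Cell.reset) : Marked v' := by
  obtain ⟨u, rfl, hu⟩ := hv
  cases v' with
  | nil => simp at h
  | cons c u' =>
    simp only [List.map_cons, List.cons.injEq] at h
    refine ⟨u', ?_, fun hs => hu ?_⟩
    · rw [reset_eq_start.1 h.1]
    · have h2 : Cell.start ∈ u'.map Cell.reset := List.mem_map.2 ⟨_, hs, rfl⟩
      rw [h.2] at h2
      obtain ⟨c, hc, e⟩ := List.mem_map.1 h2
      rwa [← reset_eq_start.1 e]

theorem reset_reset (c : Cell) : c.reset.reset = c.reset := by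
  cases c <;> rfl

theorem map_reset_reset (v : List Cell) : (v.map Cell.reset).map Cell.reset = v.map Cell.reset := by
  simp [reset_reset]

theorem incr_reset {v v' : List Cell} (h : incr v = some v') :
    v'.map Cell.reset = v.map Cell.reset := by
  induction v generalizing v' with
  | nil => simp [incr] at h
  | cons c v ih =>
    by_cases hc : c = .free false
    · subst hc
      simp only [incr, Option.some.injEq] at h
      subst h
      rfl
    · have h' : (incr v).map (c.reset :: ·) = some v' := by
        rcases c with _ | b | _ | _ <;> first | exact absurd rfl hc | simpa [incr] using h
      obtain ⟨u, hu, rfl⟩ := Option.map_eq_some_iff.1 h'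
      simp [ih hu, reset_reset]

theorem Marked.append {v u : List Cell} (hv : Marked v) (hu : .start ∉ u) : Marked (v ++ u) := by
  obtain ⟨v, rfl, h⟩ := hv
  exact ⟨v ++ u, rfl, by simp [h, hu]⟩

theorem Marked.extend {v : List Cell} (hv : Marked v) : Marked (extend v) := by
  refine Marked.append (hv.of_map_reset (map_reset_reset v)) ?_
  simp

theorem Marked.nextWord {v : List Cell} (hv : Marked v) : Marked (nextWord v) := by
  unfold LowSpeed.nextWord
  cases h : incr v with
  | none => exact hv.extend
  | some v' => exact hv.of_map_reset (incr_reset h)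

theorem foldl_undoStep_mark (n : ℕ) (T : Fin (M.k + 1) → Tape (Sym M.Aux)) :
    (List.replicate n mark).foldl undoStep T = T := by
  induction n with
  | zero => rfl
  | succ n ih => rw [List.replicate_succ, List.foldl_cons, undoStep_mark, ih]

theorem undo_to_ready (x : List Bool) (v : List Cell)
    (T : Fin (M.k + 1) → Tape (Sym M.Aux)) (hist : List (Record M.k M.Aux))
    (hl : hist.length = v.length - 1) (hT : hist.foldl undoStep T = (M.init x).tape) :
    (simulator M w).Within (2 * v.length + 1) ⟨.undo false, T, zip [] v, zipLeft hist []⟩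
      (ready M w x v) := by
  refine ((undo_loop (w := w) T (zip [] v) hist []).tail (c'' := ready M w x v) ?_).mono (by omega)
  rw [hT, hl]
  simp [TwoProgram.step, simulator, act_keep, ready, simCfg]
  rfl

/-- Filling leaves the history head at the right end. Undoing marks changes no tape and merely
brings the head back. By `hlen`, no old record survives the filling. -/
theorem fill_to_ready (x : List Bool) (v : List Cell) (hv : Marked v)
    (l : List Cell) (c : Cell) (hlc : l.reverse ++ [c] = v)
    (hr : List (Record M.k M.Aux)) (hlen : hr.length < v.length) :
    (simulator M w).Within (3 * v.length + 2) ⟨.fill, (M.init x).tape, zip l [c], zip [] hr⟩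
      (ready M w x v) := by
  have h1 := fill_loop (w := w) (M.init x).tape l [c] [] hr (by simp) (by rwa [hlc])
  have hl : l.length = v.length - 1 := by rw [← hlc]; simp
  rw [hlc, List.drop_eq_nil_of_le (by omega), List.append_nil] at h1
  have h2 := undo_to_ready (w := w) x v (M.init x).tape (List.replicate l.length mark)
    (by simpa using hl) (foldl_undoStep_mark _ _)
  refine ((h1.tail ?_).trans h2).mono (by omega)
  obtain ⟨u, rfl, -⟩ := hv
  simp [TwoProgram.step, simulator, act_keep]

/-- Undoing restores the tapes of `M`, so the cost of a failed attempt depends on the length of the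
word and not on the input. The constant 20 is generous; it also covers the refill of the clock after
the word has doubled. -/
theorem ready_next {v : List Cell} (hv : Marked v) (x : List Bool)
    (hh : ∀ b, ¬ M.HaltsWithin (wordOracle v) x (v.length - 1) b) :
    (simulator M w).Within (20 * (v.length + 1) ^ 2) (ready M w x v)
      (ready M w x (nextWord v)) := by
  have hpos : 0 < v.length := List.length_pos_of_ne_nil hv.ne_nil
  obtain ⟨l, r, flag, hist, I, h1⟩ := sim_loop (w := w) hv x (v.length - 1) le_rfl
    fun s hs b hb => hh b ⟨s, hs.le, hb⟩
  have hlen : l.length + r.length = v.length := by rw [← I.word]; simp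
  have hr0 : r ≠ [] := by
    rintro rfl
    have := I.pos
    simp at hlen; omega
  set c := M.run (wordOracle v) x (v.length - 1) with hc
  have h2 : (simulator M w).step (simCfg w (v.length - 1) (v.length - 1) c l r flag hist) =
      ⟨.rewInc, c.tape, zip l r, zip hist []⟩ := by
    obtain ⟨a, r, rfl⟩ := List.exists_cons_of_ne_nil hr0
    rcases hp : M.program c.state with b | f | ⟨b, q⟩ | ⟨y, n'⟩
    · exact absurd ⟨_, le_rfl, hp⟩ (hh b)
    all_goals simp [TwoProgram.step, simulator, simCfg, hp, act_keep]
  have h3 := rewInc_loop (w := w) c.tape (zip hist []) l r hr0 (by rwa [I.word])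
  rw [I.word] at h3
  have h4 := (h1.tail h2).trans h3
  cases hi : incr v with
  | some v' =>
    have hv' : Marked v' := hv.of_map_reset (incr_reset hi)
    have hl' : v'.length = v.length := by simpa using congrArg List.length (incr_reset hi)
    obtain ⟨l₁, r₁, e, hr₁, h5⟩ := inc_loop_some (w := w) c.tape [] v v' (zip hist []) hi
    have e' : l₁.reverse ++ r₁ = v' := by simpa using e
    have h6 := rewUndo_loop (w := w) c.tape hist l₁ r₁ hr₁ (by rwa [e'])
    rw [e'] at h6
    have h7 := undo_to_ready (w := w) x v' c.tape hist (by rw [I.hist_length, hl']) I.undo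
    have hn : nextWord v = v' := by simp [nextWord, hi]
    rw [hn]
    refine (((h4.trans h5).trans h6).trans h7).mono ?_
    have : l₁.length ≤ v'.length := by rw [← e']; simp
    have h8 : (v.length - 1) * (v.length + 1) ≤ (v.length + 1) * (v.length + 1) :=
      Nat.mul_le_mul_right _ (by omega)
    nlinarith
  | none =>
    have h5 := inc_loop_none (w := w) c.tape [] v (zip hist []) hi
    rw [List.append_nil] at h5
    set z := (v.map Cell.reset).reverse with hz
    have h6 : (simulator M w).step ⟨.inc, c.tape, zip z [], zip hist []⟩ =
        ⟨.undo true, c.tape, zip (.free false :: z) [], zipLeft hist []⟩ := by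
      simp [TwoProgram.step, simulator, act_keep]
    have h7 := undo_loop_ext (w := w) c.tape (.free false :: z) hist []
    rw [I.undo, I.hist_length, List.append_nil] at h7
    have hn : nextWord v = extend v := by simp [nextWord, hi]
    rw [hn]
    have hv' : Marked (extend v) := hv.extend
    have hlen' : (extend v).length = 2 * v.length := by
      simp [extend]; omega
    obtain ⟨l₂, d, e₂, e₃⟩ : ∃ l₂ d, List.replicate (v.length - 1) (Cell.fix false) ++
        .free false :: z = d :: l₂ ∧ l₂.reverse ++ [d] = extend v := by
      cases h : List.replicate (v.length - 1) (Cell.fix false) ++ .free false :: z with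
      | nil => simp at h
      | cons d l₂ =>
        refine ⟨l₂, d, rfl, ?_⟩
        rw [← List.reverse_cons, ← h]
        simp [extend, hz]
    rw [e₂] at h7
    have h8 : (simulator M w).step ⟨.undo true, (M.init x).tape, zip (d :: l₂) [],
        zipLeft [] (List.replicate (v.length - 1) (mark : Record M.k M.Aux))⟩ =
        ⟨.fill, (M.init x).tape, zip l₂ [d], zip [] (List.replicate (v.length - 1) mark)⟩ := by
      simp [TwoProgram.step, simulator, act_keep]
    have h9 := fill_to_ready (M := M) (w := w) x (extend v) hv' l₂ d e₃
      (List.replicate (v.length - 1) mark) (by simp; omega)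
    refine ((((h4.trans h5).tail h6).trans h7).tail h8 |>.trans h9).mono ?_
    have h8 : (v.length - 1) * (v.length + 1) ≤ (v.length + 1) * (v.length + 1) :=
      Nat.mul_le_mul_right _ (by omega)
    rw [hlen']
    have : l.length ≤ v.length := by omega
    have : v.length - 1 ≤ v.length := by omega
    nlinarith

/-- The start state of the simulator. -/
def simStart (M : OracleTM) (w : List Cell) : SimState M.State w.length := .init 0

theorem init_loop (T : Fin (M.k + 1) → Tape (Sym M.Aux)) (n : ℕ) (hn : n ≤ w.length) :
    (simulator M w).Within n ⟨.init 0, T, zip [] [], zip [] []⟩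
      ⟨.init ⟨n, by omega⟩, T, zip (w.take n).reverse [], zip [] []⟩ := by
  induction n with
  | zero => exact Within.refl _ _
  | succ n ih =>
    refine (ih (by omega)).tail ?_
    have h : n < w.length := hn
    have ht : (w.take (n + 1)).reverse = w[n] :: (w.take n).reverse := by
      rw [List.take_add_one, List.getElem?_eq_getElem h]
      simp
    rw [ht]
    simp only [TwoProgram.step, simulator, dif_pos h, act_keep, act_zip_right, List.tail_nil,
      act_head]

theorem init_to_ready (hw : Marked w) (x : List Bool) :
    (simulator M w).Within (4 * w.length + 3) (initCfg (simStart M w) x) (ready M w x w) := by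
  have h1 := init_loop (w := w) (M.init x).tape w.length le_rfl
  rw [List.take_length] at h1
  obtain ⟨l, d, e⟩ : ∃ l d, w.reverse = d :: l := by
    cases h : w.reverse with
    | nil => exact absurd (List.reverse_eq_nil_iff.1 h) hw.ne_nil
    | cons d l => exact ⟨l, d, rfl⟩
  have e' : l.reverse ++ [d] = w := by
    rw [← List.reverse_cons, ← e, List.reverse_reverse]
  rw [e] at h1
  have h2 := fill_to_ready (M := M) (w := w) x w hw l d e' []
    (List.length_pos_of_ne_nil hw.ne_nil)
  refine ((h1.tail ?_).trans h2).mono (by omega)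
  simp [TwoProgram.step, simulator, act_keep]

end Simulation
/-! ### Enumerating the guesses -/

/-- The binary number that is stored in the free cells, least significant bit first. -/
def val : List Cell → ℕ
  | [] => 0
  | .free b :: v => b.toNat + 2 * val v
  | _ :: v => val v

theorem val_incr {v v' : List Cell} (h : incr v = some v') : val v' = val v + 1 := by
  induction v generalizing v' with
  | nil => simp [incr] at h
  | cons c v ih =>
    rcases c with _ | b | _ | _
    · obtain ⟨u, hu, rfl⟩ := Option.map_eq_some_iff.1 h
      have := ih hu
      exact this
    · obtain ⟨u, hu, rfl⟩ := Option.map_eq_some_iff.1 h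
      have := ih hu
      exact this
    · simp only [incr, Option.some.injEq] at h
      subst h
      simp [val]; omega
    · obtain ⟨u, hu, rfl⟩ := Option.map_eq_some_iff.1 h
      simp only [Cell.reset, val, ih hu, Bool.toNat_false, Bool.toNat_true]
      omega

theorem incr_eq_none {v : List Cell} (h : .free false ∉ v) : incr v = none := by
  induction v with
  | nil => rfl
  | cons c v ih =>
    have := ih fun hv => h (List.mem_cons_of_mem _ hv)
    rcases c with _ | b | _ | _ <;> simp_all [incr]

/-- Overflow occurs only when all guessed bits are 1, which is the largest value for the shape. -/
theorem val_le_of_incr_eq_none {u v : List Cell} (h : incr v = none)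
    (hs : u.map Cell.reset = v.map Cell.reset) : val u ≤ val v := by
  induction v generalizing u with
  | nil => simp at hs; simp [hs]
  | cons c v ih =>
    obtain ⟨d, u, rfl⟩ : ∃ d u', u = d :: u' :=
      List.exists_cons_of_ne_nil (by rintro rfl; simp at hs)
    simp only [List.map_cons, List.cons.injEq] at hs
    have hv : incr v = none ∨ c = .free false := by
      rcases c with _ | b | _ | _ <;> simp_all [incr]
    rcases hv with hv | rfl
    · have := ih hv hs.2
      clear ih
      rcases c with _ | b | _ | _ <;> rcases d with _ | b' | _ | _ <;>
        simp_all [Cell.reset, val, incr] ; omega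
    · simp [incr] at h

theorem eq_of_val_eq {u v : List Cell} (hs : u.map Cell.reset = v.map Cell.reset)
    (h : val u = val v) : u = v := by
  induction v generalizing u with
  | nil => simpa using hs
  | cons c v ih =>
    obtain ⟨d, u, rfl⟩ : ∃ d u', u = d :: u' :=
      List.exists_cons_of_ne_nil (by rintro rfl; simp at hs)
    simp only [List.map_cons, List.cons.injEq] at hs
    have key : d = c ∧ val u = val v := by
      rcases c with _ | b | _ | _ <;> rcases d with _ | b' | _ | _ <;>
        simp_all [Cell.reset, val] <;> omega
    rw [key.1, ih hs.2 key.2]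

/-- The number of free cells. -/
def numFree : List Cell → ℕ
  | [] => 0
  | .free _ :: v => numFree v + 1
  | _ :: v => numFree v

theorem val_lt (v : List Cell) : val v < 2 ^ numFree v := by
  induction v with
  | nil => simp [val, numFree]
  | cons c v ih =>
    rcases c with _ | b | b
    · exact ih
    · exact ih
    · simp only [val, numFree, pow_succ]
      have := Bool.toNat_le b
      omega

theorem numFree_append (u v : List Cell) : numFree (u ++ v) = numFree u + numFree v := by
  induction u with
  | nil => simp [numFree]
  | cons c u ih =>
    rcases c with _ | b | b <;> simp only [List.cons_append, numFree, ih]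
    omega

theorem numFree_replicate (n : ℕ) (b : Bool) : numFree (List.replicate n (.fix b)) = 0 := by
  induction n with
  | zero => rfl
  | succ n ih => simpa [List.replicate_succ, numFree] using ih

theorem numFree_eq_of_map_reset {u v : List Cell} (hs : u.map Cell.reset = v.map Cell.reset) :
    numFree u = numFree v := by
  induction v generalizing u with
  | nil => simp at hs; simp [hs]
  | cons c v ih =>
    obtain ⟨d, u, rfl⟩ : ∃ d u', u = d :: u' :=
      List.exists_cons_of_ne_nil (by rintro rfl; simp at hs)
    simp only [List.map_cons, List.cons.injEq] at hs
    have := ih hs.2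
    rcases c with _ | b | _ <;> rcases d with _ | b' | _ <;> simp_all [Cell.reset, numFree]

/-! ### The words of length `2 ^ m` and the order in which they are tried -/

section Words

variable (g : ℕ → Bool) (n₀ : ℕ) (β : ℕ → Bool)

/-- The `j`-th cell of the oracle tape, when the first `n₀` bits of the generic sequence are given
by `g` and the other ones are guessed as `β`. -/
def cellAt (j : ℕ) : Cell :=
  if j = 0 then .start
  else if 2 ^ Nat.log 2 j = j then
    (if Nat.log 2 j < n₀ then .fix (g (Nat.log 2 j)) else .free (β (Nat.log 2 j)))
  else .fix false

/-- The word of length `2 ^ m` on the oracle tape. -/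
def word (m : ℕ) : List Cell := (List.range (2 ^ m)).map (cellAt g n₀ β)

theorem cellAt_two_pow (i : ℕ) :
    cellAt g n₀ β (2 ^ i) = if i < n₀ then .fix (g i) else .free (β i) := by
  simp [cellAt, Nat.log_pow]

@[simp] theorem length_word (m : ℕ) : (word g n₀ β m).length = 2 ^ m := by
  simp [word]

theorem word_succ (m : ℕ) : word g n₀ β (m + 1) =
    word g n₀ β m ++ cellAt g n₀ β (2 ^ m) :: List.replicate (2 ^ m - 1) (.fix false) := by
  obtain ⟨N, hN⟩ : ∃ N, 2 ^ m = N + 1 := ⟨2 ^ m - 1, by have := Nat.two_pow_pos m; omega⟩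
  unfold word
  rw [pow_succ, mul_two, List.range_add, List.map_append]
  congr 1
  rw [hN, List.range_succ_eq_map, List.map_cons, List.map_cons]
  congr 1
  rw [List.map_map, List.map_map, Nat.add_sub_cancel, List.eq_replicate_iff]
  refine ⟨by simp, fun c hc => ?_⟩
  obtain ⟨i, hi, rfl⟩ := List.mem_map.1 hc
  rw [List.mem_range] at hi
  simp only [Function.comp_apply, Nat.succ_eq_add_one, ← hN]
  have hlog : Nat.log 2 (2 ^ m + (i + 1)) = m := by
    rw [Nat.log_eq_iff (Or.inr ⟨by norm_num, by omega⟩)]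
    constructor
    · omega
    · rw [pow_succ]; omega
  rw [cellAt, if_neg (by omega), hlog, if_neg (by omega)]

theorem marked_word (m : ℕ) : Marked (word g n₀ β m) := by
  induction m with
  | zero => exact ⟨[], by simp [word, cellAt], by simp⟩
  | succ m ih =>
    rw [word_succ]
    refine ih.append ?_
    rw [cellAt_two_pow]
    split <;> simp

theorem map_reset_word (m : ℕ) :
    (word g n₀ β m).map Cell.reset = word g n₀ (fun _ => false) m := by
  unfold word
  rw [List.map_map]
  refine List.map_congr_left fun j _ => ?_
  simp only [Function.comp_apply, cellAt]
  split_ifs <;> rfl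

theorem numFree_word (m : ℕ) : numFree (word g n₀ β m) ≤ m := by
  induction m with
  | zero => simp [word, cellAt, numFree]
  | succ m ih =>
    rw [word_succ, numFree_append, cellAt_two_pow]
    split <;> simp only [numFree, numFree_replicate] <;> omega

/-- The appended cell has position `2 ^ m` and thus stands for bit `m`; it must be free because `n₀
≤ m`. -/
theorem extend_of_map_reset {v : List Cell} {m : ℕ} (hm : n₀ ≤ m)
    (hv : v.map Cell.reset = word g n₀ (fun _ => false) m) :
    extend v = word g n₀ (fun _ => false) (m + 1) := by
  have hl : v.length = 2 ^ m := by simpa using congrArg List.length hv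
  rw [word_succ, extend, hv, hl, cellAt_two_pow, if_neg (by omega)]

/-- Within the words of one length, all guesses are tried. -/
theorem iterate_nextWord_val {v : List Cell} (u : List Cell)
    (hu : u.map Cell.reset = v.map Cell.reset) (n : ℕ) (hn : val v + n ≤ val u) :
    (nextWord^[n] v).map Cell.reset = v.map Cell.reset ∧ val (nextWord^[n] v) = val v + n := by
  induction n with
  | zero => exact ⟨rfl, rfl⟩
  | succ n ih =>
    obtain ⟨h1, h2⟩ := ih (by omega)
    rw [Function.iterate_succ_apply']
    cases h : incr (nextWord^[n] v) with
    | none =>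
      have := val_le_of_incr_eq_none h (hu.trans h1.symm)
      omega
    | some v' =>
      have hn : nextWord (nextWord^[n] v) = v' := by
        rw [nextWord, h]; rfl
      rw [hn, incr_reset h, val_incr h, h1, h2]
      exact ⟨rfl, by omega⟩

theorem val_word_false (m : ℕ) : val (word g n₀ (fun _ => false) m) = 0 := by
  have : ∀ v : List Cell, (∀ c ∈ v, c ≠ .free true) → val v = 0 := by
    intro v hv
    induction v with
    | nil => rfl
    | cons c v ih =>
      have := ih fun c hc => hv c (List.mem_cons_of_mem _ hc)
      rcases c with _ | _ | _ | _ <;> simp_all [val]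
  refine this _ fun c hc => ?_
  obtain ⟨j, -, rfl⟩ := List.mem_map.1 hc
  unfold cellAt
  split_ifs <;> simp

/-- The counter starts at 0 and shows `val u` after `val u` increments; at most `m` free cells give
the bound. -/
theorem iterate_nextWord_phase {m : ℕ} {u : List Cell}
    (hu : u.map Cell.reset = word g n₀ (fun _ => false) m) :
    ∃ i < 2 ^ m, nextWord^[i] (word g n₀ (fun _ => false) m) = u ∧
      ∀ j ≤ i, (nextWord^[j] (word g n₀ (fun _ => false) m)).map Cell.reset =
        word g n₀ (fun _ => false) m := by
  have hz := map_reset_word g n₀ (fun _ => false) m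
  have hv := val_word_false g n₀ m
  refine ⟨val u, ?_, ?_, fun j hj => ?_⟩
  · refine (val_lt u).trans_le (Nat.pow_le_pow_right (by norm_num) ?_)
    rw [numFree_eq_of_map_reset (hu.trans hz.symm)]
    exact numFree_word _ _ _ _
  · obtain ⟨h1, h2⟩ := iterate_nextWord_val (v := word g n₀ (fun _ => false) m) u
      (hu.trans hz.symm) (val u) (by omega)
    exact eq_of_val_eq (h1.trans (hz.trans hu.symm)) (by omega)
  · rw [(iterate_nextWord_val (v := word g n₀ (fun _ => false) m) u
      (hu.trans hz.symm) j (by omega)).1, hz]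

/-- The bound is a geometric sum over the stages. The passage to the next stage goes through the
all-ones guess, at which `incr` overflows. -/
theorem exists_iterate_nextWord {m : ℕ} (hm : n₀ ≤ m) {u : List Cell}
    (hu : u.map Cell.reset = word g n₀ (fun _ => false) m) :
    ∃ i < 2 ^ (m + 1), nextWord^[i] (word g n₀ (fun _ => false) n₀) = u ∧
      ∀ j ≤ i, ∃ m', n₀ ≤ m' ∧ m' ≤ m ∧
        (nextWord^[j] (word g n₀ (fun _ => false) n₀)).map Cell.reset =
          word g n₀ (fun _ => false) m' := by
  induction m, hm using Nat.le_induction generalizing u with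
  | base =>
    obtain ⟨i, hi, h1, h2⟩ := iterate_nextWord_phase g n₀ hu
    exact ⟨i, by rw [pow_succ]; omega, h1, fun j hj => ⟨n₀, le_rfl, le_rfl, h2 j hj⟩⟩
  | succ m hm ih =>
    obtain ⟨i, hi, h1, h2⟩ := ih (map_reset_word g n₀ (fun _ => true) m)
    obtain ⟨i', hi', h3, h4⟩ := iterate_nextWord_phase g n₀ hu
    have hnext : nextWord (word g n₀ (fun _ => true) m) = word g n₀ (fun _ => false) (m + 1) := by
      rw [← extend_of_map_reset g n₀ hm (map_reset_word g n₀ (fun _ => true) m), nextWord,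
        incr_eq_none]
      · rfl
      · intro hc
        obtain ⟨j, -, hj⟩ := List.mem_map.1 hc
        unfold cellAt at hj
        split_ifs at hj; simp at hj
    have h5 : nextWord^[i + 1] (word g n₀ (fun _ => false) n₀) =
        word g n₀ (fun _ => false) (m + 1) := by
      rw [Function.iterate_succ_apply', h1, hnext]
    refine ⟨i' + (i + 1), ?_, ?_, fun j hj => ?_⟩
    · rw [pow_succ]; omega
    · rw [Function.iterate_add_apply, h5, h3]
    · rcases Nat.lt_or_ge j (i + 1) with h | h
      · obtain ⟨m', ha, hb, hc⟩ := h2 j (by omega)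
        exact ⟨m', ha, by omega, hc⟩
      · obtain ⟨d, rfl⟩ := Nat.exists_eq_add_of_le' h
        refine ⟨m + 1, by omega, le_rfl, ?_⟩
        rw [Function.iterate_add_apply, h5]
        exact h4 d (by omega)

end Words

/-! ### The oracles that the words describe -/

/-- The sparse language of a finite sequence. -/
def finOracle (σ : List Bool) : Set (List Bool) :=
  {x | ∃ i, x = List.replicate (2 ^ i) false ∧ σ[i]? = some true}

/-- The bits on the positions `2 ^ i`, for `i < m`. -/
def readBits (v : List Cell) (m : ℕ) : List Bool :=
  (List.range m).map fun i => (v[2 ^ i]?.map Cell.bit).getD false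

/-- The shape forces zeros at all positions that are not powers of two, and the marker at position 0
counts as a zero too. -/
theorem wordOracle_eq_finOracle {g : ℕ → Bool} {n₀ m : ℕ} {v : List Cell}
    (hv : v.map Cell.reset = word g n₀ (fun _ => false) m) :
    wordOracle v = finOracle (readBits v m) := by
  have hlen : v.length = 2 ^ m := by simpa using congrArg List.length hv
  ext x
  constructor
  · rintro ⟨j, rfl, hj⟩
    obtain ⟨c, hc, hb⟩ : ∃ c, v[j]? = some c ∧ c.bit = true := by
      cases h : v[j]? with
      | none => simp [h] at hj
      | some c => exact ⟨c, rfl, by simpa [h] using hj⟩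
    have hjm : j < 2 ^ m := by
      rw [← hlen]
      exact (List.getElem?_eq_some_iff.1 hc).1
    have hr : c.reset = cellAt g n₀ (fun _ => false) j := by
      have := congrArg (·[j]?) hv
      simpa [hc, word, hjm] using this
    unfold cellAt at hr
    split_ifs at hr with h0 h1 h2
    · cases c <;> simp_all [Cell.reset, Cell.bit]
    all_goals first
      | (cases c <;> simp_all [Cell.reset, Cell.bit]; done)
      | (refine ⟨Nat.log 2 j, by rw [h1], ?_⟩
         have : Nat.log 2 j < m := by
           rw [← Nat.pow_lt_pow_iff_right (a := 2) (by norm_num), h1]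
           exact hjm
         simp [readBits, this, h1, hc, hb])
  · rintro ⟨i, rfl, hi⟩
    refine replicate_mem_wordOracle.2 ?_
    simp only [readBits, List.getElem?_map, Option.map_eq_some_iff] at hi
    obtain ⟨i', hi', e⟩ := hi
    have : i' = i := by
      obtain ⟨_, h⟩ := List.getElem?_eq_some_iff.1 hi'
      simpa using h.symm
    rwa [this] at e

open Classical in
theorem pre_prefix_readBits {G : Set ℕ} {n₀ m : ℕ} (hm : n₀ ≤ m) {v : List Cell}
    (hv : v.map Cell.reset = word (fun i => decide (i ∈ G)) n₀ (fun _ => false) m) :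
    pre G n₀ <+: readBits v m := by
  obtain ⟨d, rfl⟩ := Nat.exists_eq_add_of_le hm
  unfold readBits pre
  rw [List.range_add, List.map_append]
  have : (List.range n₀).map (fun i => decide (i ∈ G)) =
      (List.range n₀).map fun i => (v[2 ^ i]?.map Cell.bit).getD false := by
    refine List.map_congr_left fun i hi => ?_
    rw [List.mem_range] at hi
    have hi2 : 2 ^ i < 2 ^ (n₀ + d) := Nat.pow_lt_pow_right (by norm_num) (by omega)
    have := congrArg (·[2 ^ i]?) hv
    simp only [word, List.getElem?_map, List.getElem?_range hi2, Option.map_some, cellAt_two_pow,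
      if_pos hi] at this
    obtain ⟨c, hc, e⟩ := Option.map_eq_some_iff.1 this
    rw [hc]
    cases c <;> simp_all [Cell.reset, Cell.bit]
  rw [this]
  exact List.prefix_append _ _

open Classical in
theorem readBits_word (G : Set ℕ) (n₀ m : ℕ) :
    readBits (word (fun i => decide (i ∈ G)) n₀ (fun i => decide (i ∈ G)) m) m = pre G m := by
  unfold readBits pre
  refine List.map_congr_left fun i hi => ?_
  rw [List.mem_range] at hi
  have hi2 : 2 ^ i < 2 ^ m := Nat.pow_lt_pow_right (by norm_num) hi
  simp only [word, List.getElem?_map, List.getElem?_range hi2, Option.map_some, cellAt_two_pow]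
  split <;> rfl

/-! ### Low for speed from an upper bound on the guesses -/

/-! ### Bounded runs use a bounded part of the oracle -/

namespace OracleTM

variable {M : OracleTM}

theorem run_succ (A : Set (List Bool)) (x : List Bool) (s : ℕ) :
    M.run A x (s + 1) = M.step A (M.run A x s) :=
  Function.iterate_succ_apply' _ _ _

theorem length_queryTape_step (A : Set (List Bool)) (c : M.Cfg) :
    (M.step A c).queryTape.length ≤ c.queryTape.length + 1 := by
  unfold step
  split <;> simp

theorem length_queryTape_run (A : Set (List Bool)) (x : List Bool) (s : ℕ) :
    (M.run A x s).queryTape.length ≤ s := by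
  induction s with
  | zero => simp [run, init]
  | succ s ih =>
    have := length_queryTape_step A (M.run A x s)
    rw [run_succ]
    omega

theorem step_congr {A B : Set (List Bool)} {c : M.Cfg} (h : c.queryTape ∈ A ↔ c.queryTape ∈ B) :
    M.step A c = M.step B c := by
  unfold step
  by_cases hA : c.queryTape ∈ A
  · simp only [if_pos hA, if_pos (h.1 hA)]
  · simp only [if_neg hA, if_neg fun hB => hA (h.2 hB)]

/-- The query tape grows by at most one bit per step, so the first `t` steps ask only about strings
shorter than `t`. -/
theorem run_congr {A B : Set (List Bool)} {t : ℕ} (h : ∀ z : List Bool, z.length < t →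
    (z ∈ A ↔ z ∈ B)) (x : List Bool) {s : ℕ} (hs : s ≤ t) : M.run A x s = M.run B x s := by
  induction s with
  | zero => rfl
  | succ s ih =>
    rw [run_succ, run_succ, ih (by omega)]
    exact step_congr (h _ ((length_queryTape_run B x s).trans_lt (by omega)))

theorem HaltsWithin.congr {A B : Set (List Bool)} {t : ℕ} (h : ∀ z : List Bool, z.length < t →
    (z ∈ A ↔ z ∈ B)) {x : List Bool} {b : Bool} (hA : M.HaltsWithin A x t b) :
    M.HaltsWithin B x t b := by
  obtain ⟨s, hs, e⟩ := hA
  exact ⟨s, hs, by rwa [← run_congr h x hs]⟩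

theorem HaltsWithin.mono {A : Set (List Bool)} {t t' : ℕ} (h : t ≤ t') {x : List Bool} {b : Bool}
    (hA : M.HaltsWithin A x t b) : M.HaltsWithin A x t' b := by
  obtain ⟨s, hs, e⟩ := hA
  exact ⟨s, hs.trans h, e⟩

theorem run_add_of_halt {A : Set (List Bool)} {x : List Bool} {s : ℕ} {b : Bool}
    (h : M.program (M.run A x s).state = .halt b) (d : ℕ) : M.run A x (d + s) = M.run A x s := by
  induction d with
  | zero => rw [Nat.zero_add]
  | succ d ih =>
    rw [show d + 1 + s = (d + s) + 1 by omega, run_succ, ih]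
    unfold step
    rw [h]

/-- The output does not depend on the time bound. -/
theorem HaltsWithin.unique {A : Set (List Bool)} {t t' : ℕ} {x : List Bool} {b b' : Bool}
    (h : M.HaltsWithin A x t b) (h' : M.HaltsWithin A x t' b') : b = b' := by
  obtain ⟨s, -, e⟩ := h
  obtain ⟨s', -, e'⟩ := h'
  have h1 := run_add_of_halt e s'
  have h2 := run_add_of_halt e' s
  rw [Nat.add_comm] at h2
  rw [← h1, h2, e'] at e
  simpa using e.symm

end OracleTM

theorem getElem?_pre (G : Set ℕ) (m i : ℕ) : (pre G m)[i]? = some true ↔ i < m ∧ i ∈ G := by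
  simp only [pre, List.getElem?_map, Option.map_eq_some_iff]
  constructor
  · rintro ⟨j, hj, e⟩
    obtain ⟨h, rfl⟩ := List.getElem?_eq_some_iff.1 hj
    simp at h e
    exact ⟨h, e⟩
  · rintro ⟨h, hG⟩
    exact ⟨i, List.getElem?_range h, by simpa using hG⟩

theorem mem_finOracle_pre_iff (G : Set ℕ) {m : ℕ} {z : List Bool} (hz : z.length < 2 ^ m) :
    z ∈ finOracle (pre G m) ↔ z ∈ sparse G := by
  constructor
  · rintro ⟨i, rfl, hi⟩
    exact ⟨i, ((getElem?_pre G m i).1 hi).2, rfl⟩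
  · rintro ⟨i, hi, rfl⟩
    rw [List.length_replicate, Nat.pow_lt_pow_iff_right (by norm_num)] at hz
    exact ⟨i, rfl, (getElem?_pre G m i).2 ⟨hz, hi⟩⟩

/-! ### Sequences of attempts -/

section Attempts

variable {M : OracleTM} {w : List Cell}

theorem marked_iterate {v : List Cell} (hv : Marked v) (i : ℕ) : Marked (nextWord^[i] v) := by
  induction i with
  | zero => exact hv
  | succ i ih => rw [Function.iterate_succ_apply']; exact ih.nextWord

/-- An attempt that halts, rightly or wrongly, stops the simulator. So either one of the first `i`
attempts has produced the output, or all of them have failed and the next guess is set up. -/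
theorem ready_iterate {v : List Cell} (hv : Marked v) (x : List Bool) (N i : ℕ)
    (hN : ∀ j < i, (nextWord^[j] v).length ≤ N) :
    (∃ j < i, ∃ b, M.HaltsWithin (wordOracle (nextWord^[j] v)) x
        ((nextWord^[j] v).length - 1) b ∧
      (simulator M w).HaltsIn (i * (20 * (N + 1) ^ 2)) (ready M w x v) b) ∨
    (simulator M w).Within (i * (20 * (N + 1) ^ 2)) (ready M w x v)
      (ready M w x (nextWord^[i] v)) := by
  induction i with
  | zero => exact Or.inr (Within.refl _ _)
  | succ i ih =>
    rcases ih fun j hj => hN j (by omega) with ⟨j, hj, b, h1, h2⟩ | h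
    · exact Or.inl ⟨j, by omega, b, h1, h2.mono (Nat.mul_le_mul_right _ (Nat.le_succ i))⟩
    · have hm := marked_iterate hv i
      have hl := hN i (by omega)
      set u := nextWord^[i] v with hu
      have hp : (u.length + 1) ^ 2 ≤ (N + 1) ^ 2 := Nat.pow_le_pow_left (by omega) 2
      by_cases hh : ∃ b, M.HaltsWithin (wordOracle u) x (u.length - 1) b
      · obtain ⟨b, hb⟩ := hh
        obtain ⟨b', h1, h2⟩ := ready_halts (w := w) hm le_rfl hb
        refine Or.inl ⟨i, by omega, b', by rwa [← hu], ?_⟩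
        refine (HaltsIn.of_within h h2).mono ?_
        rw [Nat.succ_mul i]
        refine Nat.add_le_add_left ?_ _
        nlinarith
      · push Not at hh
        refine Or.inr ?_
        rw [Function.iterate_succ_apply', Nat.succ_mul, ← hu]
        refine h.trans ((ready_next hm x hh).mono ?_)
        exact Nat.mul_le_mul_left _ hp

end Attempts

open Classical in
/-- If all sufficiently long runs of `M` with guesses that extend a prefix of `G` give correct
answers, then the simulator decides the language that `M` decides with oracle `sparse G`, with a
polynomial loss of time. -/
theorem exists_oracleFree_of_forall_extension {G : Set ℕ} {L : Set (List Bool)} {M : OracleTM}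
    {f : List Bool → ℕ} (hM : M.DecidesInTime (sparse G) L f) {n₀ : ℕ}
    (hG : ∀ τ, pre G n₀ <+: τ → ∀ x t b, t < 2 ^ τ.length → M.HaltsWithin (finOracle τ) x t b →
      (b = true ↔ x ∈ L)) :
    ∃ (M' : OracleTM) (p : Polynomial ℕ),
      M'.OracleFree ∧ M'.DecidesInTime ∅ L fun x => p.eval (f x) := by
  have := M.finite_aux
  have := M.finite_state
  set g : ℕ → Bool := fun i => decide (i ∈ G) with hg
  set w := word g n₀ (fun _ => false) n₀ with hw
  have hwm : Marked w := marked_word _ _ _ _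
  have hwl : w.length = 2 ^ n₀ := length_word _ _ _ _
  -- The polynomial is the cost of writing `w`, plus a bound on the number of attempts times a bound
  -- on the cost of one.
  refine ⟨(simulator M w).toTM (simStart M w),
    Polynomial.C (4 * w.length + 3) + (Polynomial.C (2 ^ (n₀ + 2)) * (Polynomial.X + 1)) *
      (20 * (Polynomial.C (2 ^ (n₀ + 1)) * (Polynomial.X + 1) + 1) ^ 2),
    toTM_oracleFree _ _, fun x => ?_⟩
  obtain ⟨b, hb, -⟩ := hM x
  -- Large enough for the true guess to halt in time (`hf`), and small enough for `2 ^ m` to be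
  -- linear in `f x` (`h2m`).
  set m := n₀ + (Nat.log 2 (f x + 1) + 1) with hm
  have h2m : 2 ^ m ≤ 2 ^ (n₀ + 1) * (f x + 1) := by
    have := Nat.pow_log_le_self 2 (show f x + 1 ≠ 0 by omega)
    rw [hm, show n₀ + (Nat.log 2 (f x + 1) + 1) = (n₀ + 1) + Nat.log 2 (f x + 1) by omega, pow_add]
    exact Nat.mul_le_mul_left _ this
  have hf : f x < 2 ^ m := by
    have h1 : f x + 1 < 2 ^ (Nat.log 2 (f x + 1) + 1) := Nat.lt_pow_succ_log_self (by norm_num) _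
    have h2 : 2 ^ (Nat.log 2 (f x + 1) + 1) ≤ 2 ^ m := Nat.pow_le_pow_right (by norm_num) (by omega)
    omega
  set u := word g n₀ g m with hu
  have hum : u.map Cell.reset = word g n₀ (fun _ => false) m := map_reset_word _ _ _ _
  have hul : u.length = 2 ^ m := length_word _ _ _ _
  obtain ⟨i, hi, hiu, hij⟩ := exists_iterate_nextWord g n₀ (show n₀ ≤ m by omega) hum
  have hlen : ∀ j < i + 1, (nextWord^[j] w).length ≤ 2 ^ m := by
    intro j hj
    obtain ⟨m', h1, h2, h3⟩ := hij j (by omega)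
    have : (nextWord^[j] w).length = 2 ^ m' := by simpa using congrArg List.length h3
    rw [this]
    exact Nat.pow_le_pow_right (by norm_num) h2
  have key : ∃ j < i + 1, ∃ b, M.HaltsWithin (wordOracle (nextWord^[j] w)) x
        ((nextWord^[j] w).length - 1) b ∧
      (simulator M w).HaltsIn ((i + 1) * (20 * (2 ^ m + 1) ^ 2)) (ready M w x w) b := by
    rcases ready_iterate (M := M) (w := w) hwm x (2 ^ m) i fun j hj => hlen j (by omega) with
      ⟨j, hj, b, h1, h2⟩ | h
    · exact ⟨j, by omega, b, h1, h2.mono (Nat.mul_le_mul_right _ (Nat.le_succ i))⟩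
    · have h1 : M.HaltsWithin (wordOracle u) x (u.length - 1) b := by
        rw [wordOracle_eq_finOracle hum, readBits_word]
        refine OracleTM.HaltsWithin.mono (t := f x) (by omega) (hb.congr fun z hz => ?_)
        exact (mem_finOracle_pre_iff G (hz.trans hf)).symm
      obtain ⟨b', h2, h3⟩ := ready_halts (w := w) (marked_word _ _ _ _) le_rfl h1
      rw [hiu] at h
      refine ⟨i, by omega, b', by rwa [hiu], (HaltsIn.of_within h h3).mono ?_⟩
      rw [Nat.succ_mul i, hul]
      refine Nat.add_le_add_left ?_ _
      nlinarith
  obtain ⟨j, hj, b', h1, h2⟩ := key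
  refine ⟨b', ?_, ?_⟩
  · obtain ⟨s, hs, e⟩ := HaltsIn.of_within (init_to_ready (M := M) hwm x) h2
    refine haltsWithin_toTM _ _ (hs.trans ?_) e
    simp only [Polynomial.eval_add, Polynomial.eval_mul, Polynomial.eval_C, Polynomial.eval_X,
      Polynomial.eval_one, Polynomial.eval_pow, Polynomial.eval_ofNat]
    refine Nat.add_le_add_left (Nat.mul_le_mul ?_ ?_) _
    · refine (Nat.succ_le_of_lt hi).trans ?_
      rw [pow_succ, show n₀ + 2 = (n₀ + 1) + 1 by omega, pow_succ 2 (n₀ + 1)]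
      nlinarith
    · exact Nat.mul_le_mul_left _ (Nat.pow_le_pow_left (Nat.succ_le_succ h2m) 2)
  -- Whichever guess has halted, it extends `pre G n₀` and its run has fewer than `2 ^ m'` steps, so
  -- `hG` certifies the answer.
  · obtain ⟨m', h3, -, h4⟩ := hij j (by omega)
    rw [wordOracle_eq_finOracle h4] at h1
    refine hG _ (pre_prefix_readBits h3 h4) x _ b' ?_ h1
    have : (nextWord^[j] w).length = 2 ^ m' := by simpa using congrArg List.length h4
    rw [this]
    have := Nat.two_pow_pos m'
    simp only [readBits, List.length_map, List.length_range]
    omega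

/-! ### Computability of the simulation -/

theorem rePred_exists {α β : Type} [Primcodable α] [Primcodable β] {p : α × β → Bool}
    (hp : Computable p) : REPred fun a => ∃ b, p (a, b) = true := by
  have h1 : Computable₂ fun (a : α) (n : ℕ) =>
      (Encodable.decode (α := β) n).bind fun b => bif p (a, b) then some () else none := by
    refine Computable.option_bind (Computable.decode.comp Computable.snd) ?_
    refine Computable.cond (hp.comp ?_) (Computable.const _) (Computable.const _)
    exact Computable.pair (Computable.fst.comp Computable.fst) Computable.snd
  refine (Partrec.dom_re (Partrec.rfindOpt h1)).of_eq fun a => ?_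
  rw [Nat.rfindOpt_dom]
  constructor
  · rintro ⟨n, u, h⟩
    obtain ⟨b, -, h⟩ := Option.bind_eq_some_iff.1 h
    refine ⟨b, ?_⟩
    cases hb : p (a, b) <;> simp_all
  · rintro ⟨b, hb⟩
    exact ⟨Encodable.encode b, (), by simp [hb]⟩

theorem primrec_two_pow : Primrec fun n : ℕ => 2 ^ n := by
  refine (Primrec.nat_rec₁ 1 (f := fun _ m => 2 * m)
    (Primrec.nat_double.comp Primrec.snd)).of_eq fun n => ?_
  induction n with
  | zero => rfl
  | succ n ih => rw [pow_succ, mul_comm, ← ih]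

/-- The existential is bounded: `σ[i]? = some true` forces `i < σ.length`. -/
theorem primrecRel_mem_finOracle :
    PrimrecRel fun (σ z : List Bool) => z ∈ finOracle σ := by
  let R : ℕ → List Bool × List Bool → Prop := fun i y =>
    y.2 = (List.range (2 ^ i)).map (fun _ => false) ∧ y.1[i]? = some true
  have hR : PrimrecRel R := by
    refine PrimrecPred.and (Primrec.eq.comp (Primrec.snd.comp Primrec.snd) ?_)
      (Primrec.eq.comp (Primrec.list_getElem?.comp (Primrec.fst.comp Primrec.snd) Primrec.fst)
        (Primrec.const _))
    exact Primrec.list_map (Primrec.list_range.comp (primrec_two_pow.comp Primrec.fst))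
      (Primrec.const false).to₂
  refine (hR.exists_mem_list.comp (Primrec.list_range.comp (Primrec.list_length.comp Primrec.fst))
    (Primrec.pair Primrec.fst Primrec.snd)).of_eq fun p => ?_
  simp only [R, List.mem_range, finOracle, Set.mem_ofPred_eq, List.map_const', List.length_range]
  exact ⟨fun ⟨i, _, h⟩ => ⟨i, h⟩, fun ⟨i, h⟩ => ⟨i, (List.getElem?_eq_some_iff.1 h.2).1, h⟩⟩

section Simulate

variable (M : OracleTM)

/-- A configuration, with the tapes given by two lists. -/
abbrev ListCfg : Type :=
  M.State × (Fin (M.k + 1) → List (Sym M.Aux) × List (Sym M.Aux)) × List Bool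

variable {M}

/-- The configuration that is given by lists. -/
def ListCfg.toCfg (d : ListCfg M) : M.Cfg :=
  ⟨d.1, fun i => Tape.mk₂ (d.2.1 i).1 (d.2.1 i).2, d.2.2⟩

/-- The scanned symbols. -/
def ListCfg.heads (d : ListCfg M) : Fin (M.k + 1) → Sym M.Aux := fun i => (d.2.1 i).2.headI

/-- A head movement, as a Boolean. -/
def dirBool : Option Dir → Option Bool
  | none => none
  | some .left => some false
  | some .right => some true

/-- Write a symbol and move the head, on a tape that is given by two lists. -/
def listAct {Γ : Type} [Inhabited Γ] (T : List Γ × List Γ) (a : Γ × Option Bool) :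
    List Γ × List Γ :=
  if a.2 = some true then (a.1 :: T.1, T.2.tail)
  else if a.2 = some false then (T.1.tail, T.1.headI :: a.1 :: T.2.tail)
  else (T.1, a.1 :: T.2.tail)

theorem listAct_toTape {Γ : Type} [Inhabited Γ] (T : List Γ × List Γ) (b : Γ) (d : Option Dir) :
    Tape.mk₂ (listAct T (b, dirBool d)).1 (listAct T (b, dirBool d)).2 =
      OracleTM.shift d ((Tape.mk₂ T.1 T.2).write b) := by
  obtain ⟨l, r⟩ := T
  have hw : (Tape.mk₂ l r).write b = Tape.mk₂ l (b :: r.tail) := rfl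
  rw [hw]
  rcases d with _ | _ | _
  · rfl
  · change _ = Tape.move .left (Tape.mk' (ListBlank.mk l) (ListBlank.mk (b :: r.tail)))
    rw [Tape.move_left_mk']; rfl
  · change _ = Tape.move .right (Tape.mk' (ListBlank.mk l) (ListBlank.mk (b :: r.tail)))
    rw [Tape.move_right_mk']; rfl

/-- What happens on the tapes in a step. -/
def tapeTable (p : M.State × (Fin (M.k + 1) → Sym M.Aux)) :
    Fin (M.k + 1) → Sym M.Aux × Option Bool :=
  match M.program p.1 with
  | .work f => fun i => (((f p.2).2 i).1, dirBool ((f p.2).2 i).2)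
  | _ => fun i => (p.2 i, none)

/-- The next state, given the answer to a possible query. -/
def stateTable (p : (M.State × (Fin (M.k + 1) → Sym M.Aux)) × Bool) : M.State :=
  match M.program p.1.1 with
  | .halt _ => p.1.1
  | .work f => (f p.1.2).1
  | .append _ q => q
  | .query y n => if p.2 then y else n

/-- Whether the query tape is erased, and what is appended to it. -/
def queryTable (q : M.State) : Bool × List Bool :=
  match M.program q with
  | .append b _ => (false, [b])
  | .query _ _ => (true, [])
  | _ => (false, [])

/-- The output in a halting state. -/
def outTable (q : M.State) : Option Bool :=
  match M.program q with
  | .halt b => some b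
  | _ => none

open Classical in
/-- One step on configurations that are given by lists. -/
noncomputable def listStep (σ : List Bool) (d : ListCfg M) : ListCfg M :=
  (stateTable ((d.1, d.heads), decide (d.2.2 ∈ finOracle σ)),
    fun i => listAct (d.2.1 i) (tapeTable (d.1, d.heads) i),
    (bif (queryTable d.1).1 then [] else d.2.2) ++ (queryTable d.1).2)

theorem mk₂_head_tail {Γ : Type} [Inhabited Γ] (T : List Γ × List Γ) :
    Tape.mk₂ (listAct T (T.2.headI, none)).1 (listAct T (T.2.headI, none)).2 =
      Tape.mk₂ T.1 T.2 := by
  have h := listAct_toTape T T.2.headI none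
  rw [show dirBool none = none from rfl] at h
  rw [h]
  exact Tape.write_self (Tape.mk₂ T.1 T.2)

/-- Pairs of lists can be coded by numbers, which makes the simulation primitive recursive.
Different lists may give the same tape, so the comparison map goes from lists to tapes. -/
theorem toCfg_listStep (σ : List Bool) (d : ListCfg M) :
    (listStep σ d).toCfg = M.step (finOracle σ) d.toCfg := by
  unfold listStep ListCfg.toCfg OracleTM.step tapeTable stateTable queryTable
  dsimp only
  rcases M.program d.1 with b | f | ⟨b, q⟩ | ⟨y, n⟩
  · simp [ListCfg.heads, mk₂_head_tail]
  · simp only [listAct_toTape, cond_false, List.append_nil]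
    rfl
  · simp [ListCfg.heads, mk₂_head_tail]
  · by_cases h : d.2.2 ∈ finOracle σ
    · simp [ListCfg.heads, mk₂_head_tail, h]
    · simp [ListCfg.heads, mk₂_head_tail, h]

/-- The initial configuration, given by lists. -/
def listInit (M : OracleTM) (x : List Bool) : ListCfg M :=
  (M.start, fun i => ([], if i = 0 then x.map Sym.bit else []), [])

theorem toCfg_iterate (σ x : List Bool) (t : ℕ) :
    ((listStep σ)^[t] (listInit M x)).toCfg = M.run (finOracle σ) x t := by
  induction t with
  | zero => rfl
  | succ t ih => rw [Function.iterate_succ_apply', toCfg_listStep, ih, OracleTM.run_succ]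

theorem outTable_eq_some {q : M.State} {b : Bool} :
    outTable q = some b ↔ M.program q = .halt b := by
  unfold outTable
  cases M.program q <;> simp

/-- A halted configuration no longer changes, so it suffices to inspect time `t`, which is a
decidable test. -/
theorem haltsWithin_iff (σ x : List Bool) (t : ℕ) (b : Bool) :
    M.HaltsWithin (finOracle σ) x t b ↔
      outTable ((listStep σ)^[t] (listInit M x)).1 = some b := by
  rw [outTable_eq_some]
  have : ((listStep σ)^[t] (listInit M x)).1 = (M.run (finOracle σ) x t).state :=
    congrArg OracleTM.Cfg.state (toCfg_iterate σ x t)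
  rw [this]
  constructor
  · rintro ⟨s, hs, e⟩
    obtain ⟨d, rfl⟩ := Nat.exists_eq_add_of_le' hs
    rwa [OracleTM.run_add_of_halt e]
  · exact fun h => ⟨t, le_rfl, h⟩

section Primrec

variable [Primcodable M.State] [Primcodable M.Aux]

theorem primrec_listAct {Γ : Type} [Primcodable Γ] [Inhabited Γ] :
    Primrec₂ (listAct : List Γ × List Γ → Γ × Option Bool → List Γ × List Γ) := by
  have h2 : Primrec fun p : (List Γ × List Γ) × Γ × Option Bool => p.2.2 :=
    Primrec.snd.comp Primrec.snd
  have hl : Primrec fun p : (List Γ × List Γ) × Γ × Option Bool => p.1.1 :=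
    Primrec.fst.comp Primrec.fst
  have hr : Primrec fun p : (List Γ × List Γ) × Γ × Option Bool => p.1.2.tail :=
    Primrec.list_tail.comp (Primrec.snd.comp Primrec.fst)
  have ha : Primrec fun p : (List Γ × List Γ) × Γ × Option Bool => p.2.1 :=
    Primrec.fst.comp Primrec.snd
  exact Primrec.ite (Primrec.eq.comp h2 (Primrec.const _))
    (Primrec.pair (Primrec.list_cons.comp ha hl) hr)
    (Primrec.ite (Primrec.eq.comp h2 (Primrec.const _))
      (Primrec.pair (Primrec.list_tail.comp hl)
        (Primrec.list_cons.comp (Primrec.list_headI.comp hl) (Primrec.list_cons.comp ha hr)))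
      (Primrec.pair hl (Primrec.list_cons.comp ha hr)))

open Classical in
theorem primrec_listStep [Finite M.State] [Finite M.Aux] :
    Primrec₂ (listStep : List Bool → ListCfg M → ListCfg M) := by
  have hq : Primrec fun p : List Bool × ListCfg M => p.2.1 := Primrec.fst.comp Primrec.snd
  have hT : Primrec fun p : List Bool × ListCfg M => p.2.2.1 :=
    Primrec.fst.comp (Primrec.snd.comp Primrec.snd)
  have hs : Primrec fun p : List Bool × ListCfg M => p.2.2.2 :=
    Primrec.snd.comp (Primrec.snd.comp Primrec.snd)
  have hh : Primrec fun p : List Bool × ListCfg M => p.2.heads := by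
    refine Primrec.fin_curry.2 (Primrec.list_headI.comp (Primrec.snd.comp ?_))
    exact Primrec.fin_app.comp (hT.comp Primrec.fst) Primrec.snd
  have hqh := Primrec.pair hq hh
  have hq' := (Primrec.dom_finite (queryTable (M := M))).comp hq
  refine Primrec.pair ((Primrec.dom_finite stateTable).comp (Primrec.pair hqh ?_))
    (Primrec.pair (Primrec.fin_curry.2 (primrec_listAct.comp
      (Primrec.fin_app.comp (hT.comp Primrec.fst) Primrec.snd) ?_))
      (Primrec.list_append.comp (Primrec.cond (Primrec.fst.comp hq') (Primrec.const _) hs)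
        (Primrec.snd.comp hq')))
  · exact (primrecRel_mem_finOracle.comp Primrec.fst hs).decide
  · exact Primrec.fin_app.comp (((Primrec.dom_finite tapeTable).comp hqh).comp Primrec.fst)
      Primrec.snd

theorem primrec_listInit [Finite M.State] [Finite M.Aux] : Primrec (listInit M) := by
  refine Primrec.pair (Primrec.const _) (Primrec.pair (Primrec.fin_curry.2
    (Primrec.pair (Primrec.const _) (Primrec.ite (Primrec.eq.comp Primrec.snd (Primrec.const _))
      (Primrec.list_map Primrec.fst ?_) (Primrec.const _)))) (Primrec.const _))
  exact (Primrec.dom_finite _).comp Primrec.snd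

end Primrec

/-- The finite sequences whose sparse language leads `M` to a wrong answer, within a time that is
bounded by an exponential of the length of the sequence, form a computably enumerable set. -/
theorem rePred_wrong (M : OracleTM) {L : Set (List Bool)} (hL : ComputablePred fun x => x ∈ L) :
    REPred fun τ : List Bool => ∃ x t b, t < 2 ^ τ.length ∧ M.HaltsWithin (finOracle τ) x t b ∧
      ¬ (b = true ↔ x ∈ L) := by
  have := M.finite_aux
  have := M.finite_state
  obtain ⟨nA, ⟨eA⟩⟩ := Finite.exists_equiv_fin M.Aux
  obtain ⟨nS, ⟨eS⟩⟩ := Finite.exists_equiv_fin M.State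
  -- Any numbering will do: every function on a finite type is primitive recursive
  -- (`Primrec.dom_finite`).
  let _ : Primcodable M.Aux := Primcodable.ofEquiv _ eA
  let _ : Primcodable M.State := Primcodable.ofEquiv _ eS
  obtain ⟨c, hc, hcL⟩ := ComputablePred.computable_iff.1 hL
  have hcL' : ∀ x, x ∈ L ↔ c x = true := fun x => iff_of_eq (congrFun hcL x)
  have hrun : Primrec fun p : List Bool × (List Bool × ℕ) =>
      outTable ((listStep p.1)^[p.2.2] (listInit M p.2.1)).1 := by
    refine (Primrec.dom_finite outTable).comp (Primrec.fst.comp ?_)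
    exact Primrec.nat_iterate (Primrec.snd.comp Primrec.snd)
      (primrec_listInit.comp (Primrec.fst.comp Primrec.snd))
      (primrec_listStep.comp (Primrec.fst.comp Primrec.fst) Primrec.snd)
  have hlt : Primrec fun p : List Bool × (List Bool × ℕ) => decide (p.2.2 < 2 ^ p.1.length) :=
    (Primrec.nat_lt.comp (Primrec.snd.comp Primrec.snd)
      (primrec_two_pow.comp (Primrec.list_length.comp Primrec.fst))).decide
  have heq : Primrec₂ fun a b : Option Bool => decide (a = b) := Primrec.eq.decide
  have hw : Computable fun p : List Bool × (List Bool × ℕ) => some (!c p.2.1) :=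
    Computable.option_some.comp
      (Primrec.not.to_comp.comp (hc.comp (Computable.fst.comp Computable.snd)))
  have hp : Computable fun p : List Bool × (List Bool × ℕ) =>
      decide (p.2.2 < 2 ^ p.1.length) &&
        decide (outTable ((listStep p.1)^[p.2.2] (listInit M p.2.1)).1 = some (!c p.2.1)) :=
    Primrec.and.to_comp.comp hlt.to_comp (heq.to_comp.comp hrun.to_comp hw)
  refine (rePred_exists hp).of_eq fun τ => ?_
  simp only [Bool.and_eq_true, decide_eq_true_eq, Prod.exists, ← haltsWithin_iff, hcL']
  constructor
  · rintro ⟨x, t, h1, h2⟩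
    exact ⟨x, t, _, h1, h2, by cases c x <;> simp⟩
  · rintro ⟨x, t, b, h1, h2, h3⟩
    have : b = !c x := by cases b <;> cases hx : c x <;> simp_all
    exact ⟨x, t, h1, this ▸ h2⟩

end Simulate

theorem lowForSpeed_sparse {G : Set ℕ} (hG : OneGeneric G) : LowForSpeed (sparse G) := by
  intro L hL M f hM
  rcases hG _ (rePred_wrong M hL) with ⟨m, x, t, b, ht, hb, hne⟩ | ⟨n₀, h⟩
  -- A prefix of `G` in the set would make `M` err with oracle `sparse G` itself, since the run is
  -- too short to notice the truncation.
  · exfalso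
    obtain ⟨b', h1, h2⟩ := hM x
    have h3 : M.HaltsWithin (sparse G) x t b := by
      refine hb.congr fun z hz => mem_finOracle_pre_iff G (hz.trans ?_)
      simpa [pre] using ht
    rw [h3.unique h1] at hne
    exact hne h2
  · refine exists_oracleFree_of_forall_extension hM (n₀ := n₀) fun τ hτ x t b ht hb => ?_
    by_contra hne
    exact h τ hτ ⟨x, t, b, ht, hb, hne⟩

/-! ### Turing equivalence of a set with its sparse language -/

/-- The hypothesis says `char X n = e n * char Y (g n)`: a single query, masked by `e`. -/
theorem char_reducible {X Y : Set ℕ} {e g : ℕ → ℕ} (he : Primrec e) (hg : Primrec g)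
    (h : ∀ n, (n ∈ X ∧ e n = 1 ∧ g n ∈ Y) ∨ (n ∉ X ∧ (e n = 0 ∨ g n ∉ Y))) :
    TuringReducible (char X) (char Y) := by
  refine RecursiveIn.iff_nat.2 ?_
  have h1 : Nat.RecursiveIn {char Y} fun n => char Y (g n) :=
    (Nat.RecursiveIn.comp (.oracle (char Y) (Set.mem_singleton _)) (Nat.Primrec.recursiveIn (Primrec.nat_iff.1 hg))).of_eq
      fun n => Part.bind_some (g n) _
  have h2 := Nat.RecursiveIn.pair (Nat.Primrec.recursiveIn (O := {char Y}) (Primrec.nat_iff.1 he)) h1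
  have hm : Primrec fun p : ℕ => p.unpair.1 * p.unpair.2 :=
    Primrec.nat_mul.comp (Primrec.fst.comp Primrec.unpair) (Primrec.snd.comp Primrec.unpair)
  refine (Nat.RecursiveIn.comp (Nat.Primrec.recursiveIn (Primrec.nat_iff.1 hm)) h2).of_eq fun n => ?_
  rcases h n with ⟨hX, h1, hY⟩ | ⟨hX, h1 | hY⟩
  · simp [char, Seq.seq, hX, h1, hY]
  · simp [char, Seq.seq, hX, h1]
  · simp [char, Seq.seq, hX, hY]

theorem strNum_replicate (m : ℕ) : strNum (List.replicate m false) = 2 ^ m - 1 := by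
  have : ∀ a : ℕ, (List.replicate m false).foldl (fun n b => 2 * n + b.toNat) a = 2 ^ m * a := by
    induction m with
    | zero => simp
    | succ m ih =>
      intro a
      rw [List.replicate_succ, List.foldl_cons, ih, pow_succ]
      simp [mul_assoc]
  rw [strNum, this, mul_one]

theorem mem_toSet_sparse {G : Set ℕ} {m : ℕ} :
    m ∈ toSet (sparse G) ↔ ∃ n ∈ G, 2 ^ 2 ^ n - 1 = m := by
  constructor
  · rintro ⟨x, ⟨n, hn, rfl⟩, rfl⟩
    exact ⟨n, hn, (strNum_replicate _).symm⟩
  · rintro ⟨n, hn, rfl⟩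
    exact ⟨_, ⟨n, hn, rfl⟩, strNum_replicate _⟩

theorem two_pow_two_pow_sub_one_injective : Function.Injective fun n : ℕ => 2 ^ 2 ^ n - 1 := by
  intro a b h
  have ha := Nat.two_pow_pos (2 ^ a)
  have hb := Nat.two_pow_pos (2 ^ b)
  have h' : 2 ^ 2 ^ a = 2 ^ 2 ^ b := by simp only at h; omega
  exact Nat.pow_right_injective le_rfl (Nat.pow_right_injective le_rfl h')

theorem le_two_pow_two_pow_sub_one (n : ℕ) : n ≤ 2 ^ 2 ^ n - 1 := by
  have h1 : n < 2 ^ n := Nat.lt_two_pow_self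
  have h2 : 2 ^ n < 2 ^ 2 ^ n := Nat.lt_two_pow_self
  omega

theorem turingEquivalent_sparse (G : Set ℕ) :
    TuringEquivalent (char (toSet (sparse G))) (char G) := by
  have hp : Primrec fun n : ℕ => 2 ^ 2 ^ n - 1 :=
    Primrec.nat_sub.comp (primrec_two_pow.comp primrec_two_pow) (Primrec.const 1)
  constructor
  -- The search inverts `n ↦ 2 ^ 2 ^ n - 1`; the bound `m` suffices by `le_two_pow_two_pow_sub_one`.
  -- For `m` outside the range, the equality test masks the meaningless value of `g m`.
  · let g : ℕ → ℕ := fun m => Nat.findGreatest (fun n => 2 ^ 2 ^ n - 1 = m) m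
    have hg : Primrec g :=
      Primrec.nat_findGreatest Primrec.id (Primrec.eq.comp (hp.comp Primrec.snd) Primrec.fst)
    have he : Primrec fun m => if 2 ^ 2 ^ g m - 1 = m then 1 else 0 :=
      Primrec.ite (Primrec.eq.comp (hp.comp hg) Primrec.id) (Primrec.const 1) (Primrec.const 0)
    refine char_reducible he hg fun m => ?_
    by_cases hm : 2 ^ 2 ^ g m - 1 = m
    · have hmem : m ∈ toSet (sparse G) ↔ g m ∈ G := by
        rw [mem_toSet_sparse]
        constructor
        · rintro ⟨n, hn, e⟩
          have : n = g m := two_pow_two_pow_sub_one_injective (e.trans hm.symm)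
          rwa [← this]
        · exact fun h => ⟨_, h, hm⟩
      rw [hmem, if_pos hm]
      tauto
    · refine Or.inr ⟨fun h => hm ?_, Or.inl (if_neg hm)⟩
      obtain ⟨n, -, e⟩ := mem_toSet_sparse.1 h
      exact Nat.findGreatest_spec (P := fun n => 2 ^ 2 ^ n - 1 = m) (m := n)
        (e ▸ le_two_pow_two_pow_sub_one n) e
  · refine char_reducible (Primrec.const 1) hp fun n => ?_
    have : 2 ^ 2 ^ n - 1 ∈ toSet (sparse G) ↔ n ∈ G := by
      rw [mem_toSet_sparse]
      exact ⟨fun ⟨k, hk, e⟩ => two_pow_two_pow_sub_one_injective e ▸ hk, fun h => ⟨n, h, rfl⟩⟩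
    rw [this]
    tauto

/-! ### The number of generic sets -/

/-- `W` is recovered as the domain of its semidecision function, and there are only countably many
partial recursive functions. -/
theorem countable_rePred : {W : Set (List Bool) | REPred fun σ => σ ∈ W}.Countable := by
  let F : Set (List Bool) → ℕ →. ℕ := fun W n =>
    (Encodable.decode (α := List Bool) n : Part (List Bool)).bind fun σ =>
      (Part.assert (σ ∈ W) fun _ => Part.some ()).map Encodable.encode
  have hF : Function.Injective F := by
    intro W V h
    ext σ
    have := congrArg Part.Dom (congrFun h (Encodable.encode σ))
    simpa [F, Part.assert] using this
  have hc : {f : ℕ →. ℕ | Partrec f}.Countable :=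
    Set.countable_coe_iff.1 (inferInstanceAs (Countable {f : ℕ →. ℕ // Partrec f}))
  exact (hc.preimage hF).mono fun W hW => Partrec.nat_iff.2 hW

/-- The set of natural numbers with a given characteristic sequence. -/
def setOfSeq (x : ℕ → Bool) : Set ℕ := {n | x n = true}

theorem pre_setOfSeq (x : ℕ → Bool) (n : ℕ) : pre (setOfSeq x) n = (List.range n).map x := by
  refine List.map_congr_left fun i _ => ?_
  cases h : x i <;> simp [setOfSeq, h]

theorem pre_congr_of_mem_cylinder {x y : ℕ → Bool} {n : ℕ}
    (h : y ∈ PiNat.cylinder (E := fun _ => Bool) x n) :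
    pre (setOfSeq y) n = pre (setOfSeq x) n := by
  rw [pre_setOfSeq, pre_setOfSeq]
  exact List.map_congr_left fun i hi => h i (List.mem_range.1 hi)

/-- The sequences that meet or avoid the set `W` of strings. -/
def meetOrAvoid (W : Set (List Bool)) : Set (ℕ → Bool) :=
  {x | (∃ n, pre (setOfSeq x) n ∈ W) ∨ ∃ n, ∀ τ, pre (setOfSeq x) n <+: τ → τ ∉ W}

theorem isOpen_of_forall_cylinder {U : Set (ℕ → Bool)}
    (h : ∀ x ∈ U, ∃ n, PiNat.cylinder (E := fun _ => Bool) x n ⊆ U) : IsOpen U := by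
  refine isOpen_iff_forall_mem_open.2 fun x hx => ?_
  obtain ⟨n, hn⟩ := h x hx
  exact ⟨_, hn, PiNat.isOpen_cylinder _ x n, PiNat.self_mem_cylinder x n⟩

theorem dense_of_forall_cylinder {U : Set (ℕ → Bool)}
    (h : ∀ (x : ℕ → Bool) (n : ℕ), ∃ y ∈ U, y ∈ PiNat.cylinder (E := fun _ => Bool) x n) :
    Dense U := by
  refine (PiNat.isTopologicalBasis_cylinders (fun _ : ℕ => Bool)).dense_iff.2 ?_
  rintro _ ⟨x, n, rfl⟩ -
  obtain ⟨y, hy, hxy⟩ := h x n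
  exact ⟨y, hxy, hy⟩

theorem isOpen_meetOrAvoid (W : Set (List Bool)) : IsOpen (meetOrAvoid W) := by
  refine isOpen_of_forall_cylinder ?_
  rintro x (⟨n, hn⟩ | ⟨n, hn⟩)
  · exact ⟨n, fun y hy => Or.inl ⟨n, by rwa [pre_congr_of_mem_cylinder hy]⟩⟩
  · exact ⟨n, fun y hy => Or.inr ⟨n, by rwa [pre_congr_of_mem_cylinder hy]⟩⟩

theorem dense_meetOrAvoid (W : Set (List Bool)) : Dense (meetOrAvoid W) := by
  refine dense_of_forall_cylinder fun x n => ?_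
  by_cases h : ∃ τ, pre (setOfSeq x) n <+: τ ∧ τ ∈ W
  · obtain ⟨τ, hτ, hW⟩ := h
    -- The extension `τ` in `W` is continued by zeros; if there is none, `x` itself avoids `W`.
    refine ⟨fun i => τ.getD i false, Or.inl ⟨τ.length, ?_⟩, fun i hi => ?_⟩
    · rw [pre_setOfSeq]
      convert hW using 1
      refine List.ext_getElem (by simp) fun i h1 h2 => ?_
      simp [List.getElem?_eq_getElem h2]
    · obtain ⟨ρ, rfl⟩ := hτ
      rw [pre_setOfSeq]
      simp [List.getElem?_append_left, hi]
  · push Not at h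
    exact ⟨x, Or.inr ⟨n, h⟩, PiNat.self_mem_cylinder x n⟩

/-- The sequences of the `1`-generic sets. -/
def genericSeqs : Set (ℕ → Bool) := {x | OneGeneric (setOfSeq x)}

theorem genericSeqs_eq : genericSeqs =
    ⋂ W ∈ {W : Set (List Bool) | REPred fun σ => σ ∈ W}, meetOrAvoid W := by
  ext x
  simp only [Set.mem_iInter]
  rfl

theorem measurableSet_genericSeqs : MeasurableSet genericSeqs := by
  rw [genericSeqs_eq]
  exact MeasurableSet.biInter countable_rePred fun W _ => (isOpen_meetOrAvoid W).measurableSet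

/-- If the set were countable, its complement would contain a dense `Gδ` set, which by the Baire
category theorem meets the dense `Gδ` set of generic sequences. -/
theorem not_countable_genericSeqs : ¬ genericSeqs.Countable := by
  intro hc
  have h1 : Dense genericSeqs := by
    rw [genericSeqs_eq]
    exact dense_biInter_of_isOpen (fun W _ => isOpen_meetOrAvoid W) countable_rePred
      fun W _ => dense_meetOrAvoid W
  have hG : IsGδ genericSeqs := by
    rw [genericSeqs_eq]
    exact IsGδ.biInter countable_rePred fun W _ => (isOpen_meetOrAvoid W).isGδ
  have h2 : Dense (⋂ x ∈ genericSeqs, {x}ᶜ : Set (ℕ → Bool)) := by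
    refine dense_biInter_of_isOpen (fun x _ => isOpen_compl_singleton) hc fun x _ => ?_
    refine dense_of_forall_cylinder fun y n => ?_
    -- Setting bit `n` opposite to that of `x` stays in the cylinder and leaves the point `x`.
    refine ⟨Function.update y n (!x n), fun h => ?_, PiNat.update_mem_cylinder y n _⟩
    have := congrFun h n
    simp at this
  have h3 : IsGδ (⋂ x ∈ genericSeqs, {x}ᶜ : Set (ℕ → Bool)) :=
    IsGδ.biInter hc fun x _ => isOpen_compl_singleton.isGδ
  obtain ⟨x, hx, hx'⟩ := (h1.inter_of_Gδ hG h3 h2).nonempty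
  exact Set.mem_iInter₂.1 hx' x hx rfl

/-- An uncountable Borel subset of a Polish space is Borel isomorphic to Cantor space. -/
theorem mk_genericSeqs : Cardinal.mk genericSeqs = Cardinal.continuum := by
  have := measurableSet_genericSeqs.standardBorel
  have hn : ¬ Countable genericSeqs := fun h => not_countable_genericSeqs (Set.countable_coe_iff.1 h)
  rw [Cardinal.mk_congr (PolishSpace.measurableEquivNatBoolOfNotCountable hn).toEquiv]
  simp

theorem sparse_injective : Function.Injective sparse := by
  have key : ∀ G n, List.replicate (2 ^ n) false ∈ sparse G ↔ n ∈ G := by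
    intro G n
    constructor
    · rintro ⟨k, hk, e⟩
      have h : 2 ^ n = 2 ^ k := by simpa using congrArg List.length e
      rwa [Nat.pow_right_injective le_rfl h]
    · exact fun h => ⟨n, h, rfl⟩
  intro G H h
  ext n
  rw [← key G, h, key]

theorem mk_LFS : Cardinal.mk LFS = Cardinal.continuum := by
  refine le_antisymm ?_ ?_
  · refine (Cardinal.mk_set_le _).trans ?_
    rw [Cardinal.mk_set, Cardinal.mk_eq_aleph0, Cardinal.two_power_aleph0]
  · rw [← mk_genericSeqs]
    refine Cardinal.mk_le_of_injective (f := fun x : genericSeqs =>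
      (⟨sparse (setOfSeq x.1), lowForSpeed_sparse x.2⟩ : LFS)) fun x y h => ?_
    have h1 : setOfSeq x.1 = setOfSeq y.1 := sparse_injective (congrArg Subtype.val h)
    refine Subtype.ext (funext fun n => ?_)
    have h2 : x.1 n = true ↔ y.1 n = true := Set.ext_iff.1 h1 n
    exact Bool.eq_iff_iff.2 h2

end LowSpeed

theorem mainTheorem5 :
    (∀ a : TuringDegree, (∃ G : Set ℕ, LowSpeed.OneGeneric G ∧ LowSpeed.deg G = a) →
      a ∈ LowSpeed.LFSDegrees) ∧
    (∀ G : Set ℕ, LowSpeed.OneGeneric G →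
      LowSpeed.LowForSpeed (LowSpeed.sparse G) ∧
      TuringEquivalent (LowSpeed.char (LowSpeed.toSet (LowSpeed.sparse G))) (LowSpeed.char G)) ∧
    Cardinal.mk LowSpeed.LFS = Cardinal.continuum := by
  refine ⟨?_, fun G hG => ⟨LowSpeed.lowForSpeed_sparse hG, LowSpeed.turingEquivalent_sparse G⟩,
    LowSpeed.mk_LFS⟩
  rintro _ ⟨G, hG, rfl⟩
  exact ⟨LowSpeed.sparse G, LowSpeed.lowForSpeed_sparse hG,
    Quotient.sound (LowSpeed.turingEquivalent_sparse G)⟩
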